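/- Let $\Delta_0,\Delta_1,\dots,\Delta_m$ be pairwise disjoint intervals of the real line. For $k=0,1,\dots,m$ let $\sigma_k$ be a finite Borel measure on $\mathbb{R}$ whose support is a compact set that contains infinitely many points and is contained in $\Delta_k$. Let $\widehat\sigma_j(z)=\int \frac{d\sigma_j(x)}{z-x}$ for $j=1,\dots,m$, and let $\ell_k$ ($k\ge 0$) be the orthonormal polynomials with respect to $\sigma_0$, with $\deg \ell_k = k$ and positive leading coefficient. Then for every multi-index $\mathbf n=(n_1,\dots,n_m)\in\mathbb{Z}_+^m$, $|\mathbf n|=n_1+\dots+n_m$, there exists at least one $\mathbf n$-th non-linear Fourier–Padé approximant of $(\widehat\sigma_1,\dots,\widehat\sigma_m)$ with respect to $\sigma_0$. That is, there exist polynomials $T,S_1,\dots,S_m$ with real coefficients such that $T\not\equiv 0$, $\deg T\le |\mathbf n|$, $\deg S_j\le |\mathbf n|-1$ for $j=1,\dots,m$ (so $S_j\equiv 0$ if $|\mathbf n|=0$), such that $T$ is different from $0$ $\sigma_0$-almost everywhere, and such that for each $j=1,\dots,m$ and each $k=0,\dots,|\mathbf n|+n_j-1$ the function $\left(\widehat\sigma_j-\frac{S_j}{T}\right)\ell_k$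 is $\sigma_0$-integrable and $$\int\left(\widehat\sigma_j-\frac{S_j}{T}\right)(x)\,\ell_k(x)\,d\sigma_0(x)=0;$$ the approximant is the vector of rational functions $\left(\frac{S_1}{T},\dots,\frac{S_m}{T}\right)$. -/

import Mathlib

open MeasureTheory Polynomial
open scoped BigOperators Polynomial

namespace FourierPade

/-- The class `M(Δ)`: finite Borel measures on the line whose support is a compact
infinite set contained in the interval `Δ`. -/
structure InClass (Δ : Set ℝ) (σ : Measure ℝ) : Prop where
  finite : IsFiniteMeasure σ
  compact_support : IsCompact σ.support
  infinite_support : σ.support.Infinite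
  support_subset : σ.support ⊆ Δ

/-- The Markov function `∫ dσ(t) / (x - t)`, at real points `x` outside the support of `σ`. -/
noncomputable def markov (σ : Measure ℝ) (x : ℝ) : ℝ :=
  ∫ t, 1 / (x - t) ∂σ

/-- The inner product `∫ p q dσ` of two polynomials. -/
noncomputable def polyInner (σ : Measure ℝ) (p q : ℝ[X]) : ℝ :=
  ∫ x, p.eval x * q.eval x ∂σ

/-- The monic orthogonal polynomial of degree `n` with respect to `σ`, by Gram–Schmidt
orthogonalization of the monomials. -/
noncomputable def monicOrtho (σ : Measure ℝ) (n : ℕ) : ℝ[X] :=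
  X ^ n - ∑ i : Fin n,
    C (polyInner σ (X ^ n) (monicOrtho σ i) /
        polyInner σ (monicOrtho σ i) (monicOrtho σ i)) * monicOrtho σ i
termination_by n
decreasing_by all_goals exact i.isLt

/-- The orthonormal polynomial `ℓ_n` of degree `n` with respect to `σ`, with positive leading
coefficient. -/
noncomputable def orthonormalPoly (σ : Measure ℝ) (n : ℕ) : ℝ[X] :=
  C (1 / √(polyInner σ (monicOrtho σ n) (monicOrtho σ n))) * monicOrtho σ n

theorem integrable_eval {Δ : Set ℝ} {σ : Measure ℝ} (h : InClass Δ σ) (p : ℝ[X]) :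
    Integrable (fun x => p.eval x) σ := by
  have := h.finite
  have h1 : IntegrableOn (fun x => p.eval x) σ.support σ :=
    p.continuous.continuousOn.integrableOn_compact h.compact_support
  have h2 : ∀ᵐ x ∂σ, x ∈ σ.support := Measure.support_mem_ae
  rwa [IntegrableOn, Measure.restrict_eq_self_of_ae_mem h2] at h1

theorem polyInner_self_pos {Δ : Set ℝ} {σ : Measure ℝ} (h : InClass Δ σ) {p : ℝ[X]}
    (hp : p ≠ 0) : 0 < polyInner σ p p := by
  have hi := integrable_eval h (p * p)
  simp only [eval_mul] at hi
  refine lt_of_le_of_ne (integral_nonneg fun x => mul_self_nonneg _) fun h0 => ?_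
  have h1 := (integral_eq_zero_iff_of_nonneg (fun x => mul_self_nonneg (p.eval x)) hi).1 h0.symm
  have h2 : σ.support ⊆ {x | p.eval x = 0} := by
    refine Measure.support_subset_of_isClosed
      (isClosed_eq p.continuous continuous_const) ?_
    filter_upwards [h1] with x hx
    simpa using hx
  refine h.infinite_support ((p.roots.toFinset.finite_toSet).subset fun x hx => ?_)
  simpa [hp] using h2 hx

theorem polyInner_sub {Δ : Set ℝ} {σ : Measure ℝ} (h : InClass Δ σ) (p q r : ℝ[X]) :
    polyInner σ (p - q) r = polyInner σ p r - polyInner σ q r := by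
  have h1 := integrable_eval h (p * r)
  have h2 := integrable_eval h (q * r)
  simp only [eval_mul] at h1 h2
  simp only [polyInner, eval_sub, sub_mul]
  exact integral_sub h1 h2

theorem polyInner_sum {Δ : Set ℝ} {σ : Measure ℝ} (h : InClass Δ σ) {ι : Type} (s : Finset ι)
    (p : ι → ℝ[X]) (r : ℝ[X]) :
    polyInner σ (∑ i ∈ s, p i) r = ∑ i ∈ s, polyInner σ (p i) r := by
  simp only [polyInner, eval_finsetSum, Finset.sum_mul]
  refine integral_finsetSum s fun i _ => ?_
  simpa using integrable_eval h (p i * r)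

theorem polyInner_C_mul (σ : Measure ℝ) (c : ℝ) (p q : ℝ[X]) :
    polyInner σ (C c * p) q = c * polyInner σ p q := by
  simp only [polyInner, eval_mul, eval_C, mul_assoc]
  exact integral_const_mul _ _

theorem polyInner_comm (σ : Measure ℝ) (p q : ℝ[X]) : polyInner σ p q = polyInner σ q p := by
  simp only [polyInner, mul_comm]

theorem monicOrtho_monic (σ : Measure ℝ) (n : ℕ) :
    (monicOrtho σ n).Monic ∧ (monicOrtho σ n).degree = n := by
  induction n using Nat.strong_induction_on with
  | _ n ih =>
    have hlt : (∑ i : Fin n, C (polyInner σ (X ^ n) (monicOrtho σ i) /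
        polyInner σ (monicOrtho σ i) (monicOrtho σ i)) * monicOrtho σ i).degree < (n : WithBot ℕ) := by
      refine (degree_sum_le _ _).trans_lt ((Finset.sup_lt_iff (WithBot.bot_lt_coe n)).2 ?_)
      intro i _
      rw [← smul_eq_C_mul]
      refine (degree_smul_le _ _).trans_lt ?_
      rw [(ih i i.isLt).2]
      exact Nat.cast_lt.2 i.isLt
    rw [monicOrtho]
    constructor
    · exact monic_X_pow_sub hlt
    · rw [degree_sub_eq_left_of_degree_lt (by rwa [degree_X_pow]), degree_X_pow]

theorem monicOrtho_orthogonal {Δ : Set ℝ} {σ : Measure ℝ} (h : InClass Δ σ) (n : ℕ) :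
    ∀ k < n, polyInner σ (monicOrtho σ n) (monicOrtho σ k) = 0 := by
  induction n using Nat.strong_induction_on with
  | _ n ih =>
    intro k hk
    have hpos := polyInner_self_pos h (monicOrtho_monic σ k).1.ne_zero
    rw [monicOrtho, polyInner_sub h, polyInner_sum h,
      Finset.sum_eq_single (⟨k, hk⟩ : Fin n)]
    · rw [polyInner_C_mul, div_mul_cancel₀ _ hpos.ne', sub_self]
    · intro i _ hi
      have hne : (i : ℕ) ≠ k := fun e => hi (Fin.ext e)
      rw [polyInner_C_mul]
      rcases lt_or_gt_of_ne hne with hlt | hgt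
      · rw [polyInner_comm σ (monicOrtho σ i) (monicOrtho σ k), ih k hk i hlt, mul_zero]
      · rw [ih i i.isLt k hgt, mul_zero]
    · simp

/-- The polynomials `ℓ_n` are orthonormal, of exact degree `n`, with positive leading
coefficient. -/
theorem orthonormalPoly_spec {Δ : Set ℝ} {σ : Measure ℝ} (h : InClass Δ σ) :
    (∀ n, (orthonormalPoly σ n).degree = n ∧ 0 < (orthonormalPoly σ n).leadingCoeff) ∧
    ∀ i j, polyInner σ (orthonormalPoly σ i) (orthonormalPoly σ j) = if i = j then 1 else 0 := by
  have hpos := fun n => polyInner_self_pos h (monicOrtho_monic σ n).1.ne_zero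
  have hc : ∀ n, 0 < 1 / √(polyInner σ (monicOrtho σ n) (monicOrtho σ n)) :=
    fun n => one_div_pos.2 (Real.sqrt_pos.2 (hpos n))
  refine ⟨fun n => ⟨?_, ?_⟩, fun i j => ?_⟩
  · rw [orthonormalPoly, degree_C_mul (hc n).ne', (monicOrtho_monic σ n).2]
  · rw [orthonormalPoly, leadingCoeff_mul, leadingCoeff_C, (monicOrtho_monic σ n).1.leadingCoeff,
      mul_one]
    exact hc n
  · rw [orthonormalPoly, orthonormalPoly, polyInner_C_mul, polyInner_comm σ (monicOrtho σ i) (C _ * _),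
      polyInner_C_mul]
    split_ifs with hij
    · subst hij
      have h1 := Real.mul_self_sqrt (hpos i).le
      have h2 := (Real.sqrt_pos.2 (hpos i)).ne'
      set a := √(polyInner σ (monicOrtho σ i) (monicOrtho σ i))
      rw [← h1]
      field_simp
    · rcases lt_or_gt_of_ne hij with hlt | hgt
      · rw [monicOrtho_orthogonal h j i hlt]; simp
      · rw [polyInner_comm σ (monicOrtho σ j) (monicOrtho σ i), monicOrtho_orthogonal h i j hgt]; simp

/-- The Fourier coefficient `c_k(f) = ∫ f ℓ_k dσ₀`. -/
noncomputable def fourierCoefficient (σ₀ : Measure ℝ) (k : ℕ) (f : ℝ → ℝ) : ℝ :=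
  ∫ x, f x * (orthonormalPoly σ₀ k).eval x ∂σ₀

/-- The error `σ̂ - S / T` on the real line. -/
noncomputable def approxError (σ : Measure ℝ) (S T : ℝ[X]) (x : ℝ) : ℝ :=
  markov σ x - S.eval x / T.eval x

/-- `(T, S₁, …, S_m)` solves the non-linear Fourier–Padé problem for the multi-index `n`.
The fields `eval_ne_zero` and `integrable` say that the integrals defining the Fourier
coefficients make sense; `degree S < |n|` is `deg S ≤ |n| - 1` (so `S = 0` if `|n| = 0`). -/
structure IsNonlinearSolution {m : ℕ} (σ₀ : Measure ℝ) (σ : Fin m → Measure ℝ)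
    (n : Fin m → ℕ) (T : ℝ[X]) (S : Fin m → ℝ[X]) : Prop where
  ne_zero : T ≠ 0
  degree_le : T.degree ≤ ((∑ i, n i : ℕ) : WithBot ℕ)
  degree_lt : ∀ j, (S j).degree < ((∑ i, n i : ℕ) : WithBot ℕ)
  eval_ne_zero : ∀ᵐ x ∂σ₀, T.eval x ≠ 0
  integrable : ∀ j, ∀ k < (∑ i, n i) + n j,
    Integrable (fun x => approxError (σ j) (S j) T x * (orthonormalPoly σ₀ k).eval x) σ₀
  coefficient_eq_zero : ∀ j, ∀ k < (∑ i, n i) + n j,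
    fourierCoefficient σ₀ k (approxError (σ j) (S j) T) = 0

/-- The vector rational function `R = (S₁ / T, …, S_m / T)` is an `n`-th non-linear
Fourier–Padé approximant of `(σ̂₁, …, σ̂_m)` with respect to `σ₀`. -/
def IsNonlinearFourierPade {m : ℕ} (σ₀ : Measure ℝ) (σ : Fin m → Measure ℝ)
    (n : Fin m → ℕ) (R : Fin m → RatFunc ℝ) : Prop :=
  ∃ (T : ℝ[X]) (S : Fin m → ℝ[X]), IsNonlinearSolution σ₀ σ n T S ∧
    ∀ j, R j = algebraMap ℝ[X] (RatFunc ℝ) (S j) / algebraMap ℝ[X] (RatFunc ℝ) T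

end FourierPade

/-!
Let `T` have degree `|n|` and let `S_j / T` agree with the Markov function of `σ_j` at the zeros of
a polynomial `W_j` of degree `|n| + n_j`, all of whose zeros lie in the hull `I₀` of the support of
`σ₀`. When `T` is orthogonal to the polynomials of degree less than `n_j` with respect to
`dσ_j / W_j`, for every `j`, such numerators `S_j` of degree less than `|n|` exist
(`exists_numerator`). Moreover, `T` has exactly `n_j` zeros in the hull of the support of `σ_j`,
and with `Q_j` the monic polynomial having these zeros, the error is
`W_j h_j / (T Q_j)`, where `h_j(z) = ∫ T Q_j / W_j dσ_j(x) / (z - x)` (`eval_mul_integral_cauchy`).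
The Fourier coefficients of the error therefore vanish as required as soon as `W_j` is the
orthogonal polynomial of degree `|n| + n_j` on `I₀` for the weight `h_j / (T Q_j)` and the measure
`σ₀`; this weight is continuous and has no zeros (`cauchyIntegral_ne_zero`).

So `T` has to be multiple orthogonal for weights depending on the `W_j`, and each `W_j` orthogonal
for a weight depending on `T` and itself. Both problems concern Angelesco systems, for which the
monic solution is unique and has its zeros in the given intervals (`IsAngelesco.roots_eq`,
`IsAngelesco.eq_of_orthogonal`). The zeros, listed increasingly, depend continuously on the weights
because they solve closed conditions uniquely in a compact space (`exists_continuous_zeros`).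
Solving both problems with the other data frozen is thus a continuous self-map of a product of
compact intervals, and Brouwer's theorem (`exists_fixedPoint_of_retract`) gives a fixed point
(`exists_coupled_orthogonal`).

Brouwer's theorem is obtained from the change of variables formula. If `u` is Lipschitz and
vanishes off the unit ball, `x ↦ x + t u(x)` maps the ball bijectively onto itself for small `t`,
so the integral of its Jacobian is the volume of the ball, for small `t` and then, being polynomial
in `t`, also for `t = 1` (`integral_det_id_add_fderiv`). A smooth retraction onto the sphere, whose
Jacobian vanishes, would contradict this.
-/

namespace FourierPade

/-! ### Brouwer's fixed point theorem -/

section Brouwer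

open Metric

/-- `t ↦ det (1 + t A)` is a polynomial of bounded degree, so by Lagrange interpolation its value
at `1` is a fixed affine combination of its values at small positive nodes. -/
theorem exists_weights_det_id_add (E : Type*) [NormedAddCommGroup E] [NormedSpace ℝ E]
    [FiniteDimensional ℝ E] {c : ℝ} (hc : 0 < c) :
    ∃ (s : Finset ℕ) (τ w : ℕ → ℝ), (∀ i, 0 < τ i ∧ τ i ≤ c) ∧ ∑ i ∈ s, w i = 1 ∧
      ∀ A : E →L[ℝ] E, (ContinuousLinearMap.id ℝ E + A).det
        = ∑ i ∈ s, w i * (ContinuousLinearMap.id ℝ E + τ i • A).det := by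
  classical
  set b := Module.finBasis ℝ E
  set d := Module.finrank ℝ E
  set s := Finset.range (d + 1)
  set τ : ℕ → ℝ := fun i => c / (i + 1)
  have hinj : Set.InjOn τ s := by
    intro i _ j _ h
    have hi : (0 : ℝ) < i + 1 := by positivity
    have hj : (0 : ℝ) < j + 1 := by positivity
    have h' : c / (i + 1 : ℝ) = c / (j + 1) := h
    rw [div_eq_div_iff hi.ne' hj.ne'] at h'
    have := mul_left_cancel₀ hc.ne' h'
    exact_mod_cast (add_right_cancel this).symm
  refine ⟨s, τ, fun i => (Lagrange.basis s τ i).eval 1, fun i => ⟨by positivity, ?_⟩, ?_, ?_⟩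
  · exact div_le_self hc.le (by linarith [Nat.cast_nonneg (α := ℝ) i])
  · rw [← eval_finsetSum, Lagrange.sum_basis hinj ⟨0, by simp [s]⟩, eval_one]
  · intro A
    set M := LinearMap.toMatrix b b (A : E →ₗ[ℝ] E)
    set p : ℝ[X] := ((X : ℝ[X]) • M.map C + (1 : Matrix (Fin d) (Fin d) ℝ).map C).det
    have hp : ∀ t : ℝ, (ContinuousLinearMap.id ℝ E + t • A).det = p.eval t := by
      intro t
      have hM : LinearMap.toMatrix b b (ContinuousLinearMap.id ℝ E + t • A : E →L[ℝ] E).toLinearMap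
          = t • M + 1 := by
        have : (ContinuousLinearMap.id ℝ E + t • A : E →L[ℝ] E).toLinearMap
            = t • (A : E →ₗ[ℝ] E) + LinearMap.id := by
          ext x; simp [add_comm]
        rw [this, map_add, map_smul, LinearMap.toMatrix_id]
      rw [ContinuousLinearMap.det, ← LinearMap.det_toMatrix b, hM, ← coe_evalRingHom,
        RingHom.map_det]
      congr 1
      ext i j
      by_cases h : i = j
      · simp [h]
        ring
      · simp [h]
        ring
    have hdeg : p.degree < s.card := by
      refine degree_le_natDegree.trans_lt ?_
      have := natDegree_det_X_add_C_le M 1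
      simp only [Fintype.card_fin] at this
      simp only [s, Finset.card_range]
      exact_mod_cast Nat.lt_succ_of_le this
    have h1 := hp 1
    rw [one_smul] at h1
    simp only [h1, hp]
    conv_lhs => rw [Lagrange.eq_interpolate hinj hdeg]
    rw [Lagrange.interpolate_apply, eval_finsetSum]
    simp [mul_comm]

/-- The determinant does not vanish along the segment from the identity to `1 + A`. -/
theorem det_id_add_pos {E : Type*} [NormedAddCommGroup E] [NormedSpace ℝ E]
    [FiniteDimensional ℝ E] {A : E →L[ℝ] E} (hA : ‖A‖ < 1) :
    0 < (ContinuousLinearMap.id ℝ E + A).det := by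
  have hcont : Continuous fun t : ℝ => (ContinuousLinearMap.id ℝ E + t • A).det :=
    ContinuousLinearMap.continuous_det.comp (by fun_prop)
  have hne : ∀ t ∈ Set.Icc (0 : ℝ) 1, (ContinuousLinearMap.id ℝ E + t • A).det ≠ 0 := by
    intro t ht h0
    have hlt : ‖-(t • A)‖ < 1 := by
      rw [norm_neg, norm_smul, Real.norm_of_nonneg ht.1]
      nlinarith [norm_nonneg A, ht.2]
    have hu := isUnit_one_sub_of_norm_lt_one hlt
    rw [sub_neg_eq_add, ContinuousLinearMap.isUnit_iff_bijective] at hu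
    have hlt := LinearMap.bot_lt_ker_of_det_eq_zero
      (f := (ContinuousLinearMap.id ℝ E + t • A : E →L[ℝ] E).toLinearMap) h0
    exact hlt.ne' (LinearMap.ker_eq_bot.2 hu.1)
  by_contra hle
  have h1 : (ContinuousLinearMap.id ℝ E + (1 : ℝ) • A).det ≤ 0 := by
    rw [one_smul]; exact not_lt.1 hle
  have h0 : 0 ≤ (ContinuousLinearMap.id ℝ E + (0 : ℝ) • A).det := by
    rw [zero_smul, add_zero]
    simp [ContinuousLinearMap.det]
  obtain ⟨t, ht, h⟩ := intermediate_value_Icc' zero_le_one hcont.continuousOn ⟨h1, h0⟩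
  exact hne t ht h

variable {E : Type*}

/-- A small Lipschitz perturbation of the identity that is trivial off a set maps that set
bijectively onto itself. -/
theorem image_add_smul_eq [NormedAddCommGroup E] [NormedSpace ℝ E]
    [FiniteDimensional ℝ E] {K : NNReal} {u : E → E} (hu : LipschitzWith K u) {B : Set E}
    (h0 : ∀ x ∉ B, u x = 0) {t : ℝ} (ht : 0 < t) (htK : t * K < 1) :
    Function.Injective (fun x => x + t • u x) ∧ (fun x => x + t • u x) '' B = B := by
  have hsmul : LipschitzWith (t.toNNReal * K) (fun x => t • u x) := by
    refine LipschitzWith.of_dist_le_mul fun x y => ?_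
    rw [dist_smul₀, Real.norm_of_nonneg ht.le, NNReal.coe_mul, Real.coe_toNNReal _ ht.le, mul_assoc]
    exact mul_le_mul_of_nonneg_left (hu.dist_le_mul x y) ht.le
  have happ : ApproximatesLinearOn (fun x => x + t • u x)
      ((ContinuousLinearEquiv.refl ℝ E : E ≃L[ℝ] E) : E →L[ℝ] E) Set.univ (t.toNNReal * K) := by
    intro x _ y _
    have := hsmul.dist_le_mul x y
    rw [dist_eq_norm, dist_eq_norm] at this
    refine (le_of_eq ?_).trans this
    congr 1
    change x + t • u x - (y + t • u y) - (x - y) = _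
    abel
  have hc : Subsingleton E ∨ t.toNNReal * K <
      ‖((ContinuousLinearEquiv.refl ℝ E).symm : E →L[ℝ] E)‖₊⁻¹ := by
    rcases subsingleton_or_nontrivial E with h | h
    · exact Or.inl h
    · right
      have : ‖((ContinuousLinearEquiv.refl ℝ E).symm : E →L[ℝ] E)‖₊ = 1 :=
        ContinuousLinearMap.nnnorm_id
      rw [this, inv_one, ← NNReal.coe_lt_coe, NNReal.coe_mul, Real.coe_toNNReal _ ht.le]
      exact_mod_cast htK
  have hinj : Function.Injective (fun x => x + t • u x) := by
    intro x y hxy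
    have := happ.injective hc (a₁ := ⟨x, trivial⟩) (a₂ := ⟨y, trivial⟩) hxy
    exact congrArg Subtype.val this
  have hfix : ∀ x ∉ B, x + t • u x = x := fun x hx => by simp [h0 x hx]
  refine ⟨hinj, Set.Subset.antisymm ?_ ?_⟩
  · rintro _ ⟨x, hx, rfl⟩
    by_contra hB
    have := hinj (hfix _ hB)
    exact hB (by rw [this]; exact hx)
  · intro y hy
    obtain ⟨x, rfl⟩ := happ.surjective hc y
    refine ⟨x, ?_, rfl⟩
    by_contra hB
    exact hB (by simpa [hfix x hB] using hy)

/-- The Jacobian of a Lipschitz perturbation of the identity, trivial off an open bounded set,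
has the volume of that set as its integral: for small perturbations this is the change of
variables formula, and both sides are polynomial in the size of the perturbation. -/
theorem integral_det_id_add_fderiv [NormedAddCommGroup E] [NormedSpace ℝ E]
    [FiniteDimensional ℝ E] [MeasurableSpace E] [BorelSpace E] (μ : Measure E) [μ.IsAddHaarMeasure]
    {K : NNReal} {u : E → E} (hu : LipschitzWith K u) {B : Set E} (hBo : IsOpen B)
    (hBb : Bornology.IsBounded B)
    (h0 : ∀ x ∉ B, u x = 0) (hd : ∀ x ∈ B, DifferentiableAt ℝ u x) :
    ∫ x in B, (ContinuousLinearMap.id ℝ E + fderiv ℝ u x).det ∂μ = μ.real B := by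
  have hc : (0 : ℝ) < 1 / (K + 1) := by positivity
  obtain ⟨s, τ, w, hτ, hw, hdet⟩ := exists_weights_det_id_add E hc
  have hτK : ∀ i, τ i * K < 1 := fun i => by
    have h1 : τ i * K ≤ 1 / (K + 1) * K := mul_le_mul_of_nonneg_right (hτ i).2 K.2
    have h2 : (1 : ℝ) / (K + 1) * K < 1 := by
      rw [one_div, inv_mul_lt_one₀ (by positivity)]; linarith
    linarith
  have hn : ∀ x, ‖fderiv ℝ u x‖ ≤ K := fun x => norm_fderiv_le_of_lipschitz ℝ hu
  have hval : ∀ i, ∫ x in B, (ContinuousLinearMap.id ℝ E + τ i • fderiv ℝ u x).det ∂μ = μ.real B := by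
    intro i
    obtain ⟨hinj, himg⟩ := image_add_smul_eq hu h0 (hτ i).1 (hτK i)
    have := integral_image_eq_integral_abs_det_fderiv_smul (F := ℝ) μ hBo.measurableSet
      (f := fun x => x + τ i • u x)
      (f' := fun x => ContinuousLinearMap.id ℝ E + τ i • fderiv ℝ u x)
      (fun x hx => ((hasFDerivAt_id x).add ((hd x hx).hasFDerivAt.const_smul (τ i))).hasFDerivWithinAt)
      hinj.injOn (fun _ => 1)
    rw [himg] at this
    simp only [smul_eq_mul, mul_one, integral_const, MeasurableSet.univ,
      measureReal_restrict_apply, Set.univ_inter] at this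
    rw [this]
    refine integral_congr_ae (Filter.Eventually.of_forall fun x => ?_)
    -- the absolute value in the change of variables formula is harmless
    refine (abs_of_pos (det_id_add_pos ?_)).symm
    rw [norm_smul, Real.norm_of_nonneg (hτ i).1.le]
    exact (mul_le_mul_of_nonneg_left (hn x) (hτ i).1.le).trans_lt (hτK i)
  have hint : ∀ i, Integrable
      (fun x => (ContinuousLinearMap.id ℝ E + τ i • fderiv ℝ u x).det) (μ.restrict B) := by
    intro i
    have hcont : Continuous fun A : E →L[ℝ] E => (ContinuousLinearMap.id ℝ E + τ i • A).det :=
      ContinuousLinearMap.continuous_det.comp (by fun_prop)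
    obtain ⟨M, hM⟩ := (isCompact_closedBall (0 : E →L[ℝ] E) (K : ℝ)).exists_bound_of_continuousOn
      hcont.continuousOn
    have : IsFiniteMeasure (μ.restrict B) := ⟨by
      rw [Measure.restrict_apply_univ]; exact hBb.measure_lt_top⟩
    refine Integrable.of_bound (C := M) ?_ (Filter.Eventually.of_forall fun x => hM _ ?_)
    · exact (hcont.measurable.comp (measurable_fderiv ℝ u)).aestronglyMeasurable
    · simpa using hn x
  rw [integral_congr_ae (Filter.Eventually.of_forall fun x => hdet (fderiv ℝ u x)),
    integral_finsetSum _ fun i _ => (hint i).const_mul _]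
  simp only [integral_const_mul, hval]
  rw [← Finset.sum_mul, hw, one_mul]

/-- A Lipschitz map on the closed unit ball that vanishes on the unit sphere stays Lipschitz when
extended by zero. -/
theorem lipschitzWith_extend_zero [NormedAddCommGroup E] [NormedSpace ℝ E] {K : NNReal}
    {v : E → E} (hv : LipschitzOnWith K v (closedBall 0 1)) (h0 : ∀ x, ‖x‖ = 1 → v x = 0) :
    LipschitzWith K ((ball (0 : E) 1).indicator v) := by
  classical
  have hin : ∀ x : E, ‖x‖ ≤ 1 → (ball (0 : E) 1).indicator v x = v x := by
    intro x hx
    by_cases h : x ∈ ball (0 : E) 1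
    · exact Set.indicator_of_mem h v
    · rw [Set.indicator_of_notMem h v, h0 x (le_antisymm hx (by simpa using h))]
  have hout : ∀ x : E, 1 ≤ ‖x‖ → (ball (0 : E) 1).indicator v x = 0 := by
    intro x hx
    exact Set.indicator_of_notMem (by simpa using hx) v
  have hmix : ∀ x y : E, ‖x‖ ≤ 1 → 1 ≤ ‖y‖ →
      dist ((ball (0 : E) 1).indicator v x) ((ball (0 : E) 1).indicator v y) ≤ K * dist x y := by
    intro x y hx hy
    -- the segment from `x` to `y` crosses the sphere, where `v` vanishes
    have hcont : ContinuousOn (fun t : ℝ => ‖x + t • (y - x)‖) (Set.Icc 0 1) := by fun_prop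
    obtain ⟨t, ht, hz⟩ := intermediate_value_Icc zero_le_one hcont
      (show (1 : ℝ) ∈ Set.Icc _ _ by simpa using ⟨hx, hy⟩)
    have hz' : ‖x + t • (y - x)‖ = 1 := hz
    rw [hin x hx, hout y hy, ← h0 _ hz']
    refine (hv.dist_le_mul x (by simpa using hx) _ (by simpa using hz'.le)).trans ?_
    refine mul_le_mul_of_nonneg_left ?_ K.2
    rw [dist_eq_norm, dist_eq_norm, sub_add_cancel_left, norm_neg, norm_smul,
      Real.norm_of_nonneg ht.1, norm_sub_rev y x]
    exact mul_le_of_le_one_left (norm_nonneg _) ht.2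
  refine LipschitzWith.of_dist_le_mul fun x y => ?_
  rcases le_total ‖x‖ 1 with hx | hx <;> rcases le_total ‖y‖ 1 with hy | hy
  · rw [hin x hx, hin y hy]
    exact hv.dist_le_mul x (by simpa using hx) y (by simpa using hy)
  · exact hmix x y hx hy
  · rw [dist_comm, dist_comm x]
    exact hmix y x hy hx
  · rw [hout x hx, hout y hy, dist_self]
    positivity

/-- The `C¹` form of the no-retraction theorem. A zero-free map could be normalized to a
retraction of the ball onto the sphere; the Jacobian of the latter vanishes, whereas its integral
is the volume of the ball. -/
theorem exists_zero_of_eq_id_on_sphere [NormedAddCommGroup E] [InnerProductSpace ℝ E]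
    [FiniteDimensional ℝ E] {F : E → E} (hF : ContDiff ℝ 1 F)
    (hid : ∀ x, ‖x‖ = 1 → F x = x) : ∃ x, F x = 0 := by
  by_contra! hne
  let _ : MeasurableSpace E := borel E
  have : BorelSpace E := ⟨rfl⟩
  set r : E → E := fun x => ‖F x‖⁻¹ • F x
  have hr : ContDiff ℝ 1 r :=
    ((hF.norm ℝ hne).inv fun x => norm_ne_zero_iff.2 (hne x)).smul hF
  have hrn : ∀ x, ‖r x‖ = 1 := fun x => by
    simp only [r, norm_smul, norm_inv, norm_norm]
    exact inv_mul_cancel₀ (norm_ne_zero_iff.2 (hne x))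
  set v : E → E := fun x => r x - x
  have hv : ContDiff ℝ 1 v := hr.sub contDiff_id
  have hv0 : ∀ x, ‖x‖ = 1 → v x = 0 := fun x hx => by
    simp [v, r, hid x hx, hx]
  obtain ⟨C, hC⟩ := (isCompact_closedBall (0 : E) 1).exists_bound_of_continuousOn
    (hv.continuous_fderiv one_ne_zero).continuousOn
  have hlip : LipschitzOnWith C.toNNReal v (closedBall 0 1) := by
    refine Convex.lipschitzOnWith_of_nnnorm_fderiv_le (𝕜 := ℝ)
      (fun x _ => (hv.differentiable one_ne_zero) x) (fun x hx => ?_) (convex_closedBall _ _)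
    rw [← NNReal.coe_le_coe, coe_nnnorm]
    exact (hC x hx).trans (Real.le_coe_toNNReal C)
  have hext := lipschitzWith_extend_zero hlip hv0
  have heq : ∀ x ∈ ball (0 : E) 1, (ball (0 : E) 1).indicator v =ᶠ[nhds x] v := fun x hx =>
    Filter.eventuallyEq_of_mem (isOpen_ball.mem_nhds hx) (fun y hy => Set.indicator_of_mem hy v)
  have hvol := integral_det_id_add_fderiv (MeasureTheory.Measure.addHaar (G := E)) hext
    isOpen_ball isBounded_ball (fun x hx => Set.indicator_of_notMem hx v)
    (fun x hx => ((hv.differentiable one_ne_zero) x).congr_of_eventuallyEq (heq x hx))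
  have hzero : ∀ x ∈ ball (0 : E) 1,
      (ContinuousLinearMap.id ℝ E + fderiv ℝ ((ball (0 : E) 1).indicator v) x).det = 0 := by
    intro x hx
    have hrd := (hr.differentiable one_ne_zero) x
    have h1 : ContinuousLinearMap.id ℝ E + fderiv ℝ ((ball (0 : E) 1).indicator v) x
        = fderiv ℝ r x := by
      rw [(heq x hx).fderiv_eq]
      have : fderiv ℝ v x = fderiv ℝ r x - ContinuousLinearMap.id ℝ E :=
        (hrd.hasFDerivAt.sub (hasFDerivAt_id x)).fderiv
      rw [this]; abel
    rw [h1]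
    by_contra hdet
    have hsurj : Function.Surjective (fderiv ℝ r x) := by
      have hu : IsUnit (fderiv ℝ r x : E →ₗ[ℝ] E) :=
        (LinearMap.isUnit_iff_isUnit_det _).2 (isUnit_iff_ne_zero.2 hdet)
      exact ((Module.End.isUnit_iff _).1 hu).2
    obtain ⟨w, hw⟩ := hsurj (r x)
    -- `‖r‖² = 1`, so `r x` is orthogonal to the range of the derivative
    have hconst : HasFDerivAt (fun y => inner ℝ (r y) (r y)) (0 : E →L[ℝ] ℝ) x := by
      have : (fun y => inner ℝ (r y) (r y)) = fun _ : E => (1 : ℝ) := by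
        funext y; rw [real_inner_self_eq_norm_sq, hrn y, one_pow]
      rw [this]; exact hasFDerivAt_const _ _
    have h2 := (hrd.hasFDerivAt.inner ℝ hrd.hasFDerivAt).unique hconst
    have h3 := congrArg (fun L : E →L[ℝ] ℝ => L w) h2
    simp [hw, hrn x] at h3
  rw [setIntegral_congr_fun measurableSet_ball hzero, integral_zero] at hvol
  have hpos : 0 < (MeasureTheory.Measure.addHaar (G := E)).real (ball (0 : E) 1) :=
    ENNReal.toReal_pos (measure_ball_pos _ _ one_pos).ne' measure_ball_lt_top.ne
  exact hpos.ne hvol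

/-- Brouwer's theorem for a continuous self-map of a Euclidean space with small values. -/
theorem exists_fixedPoint_of_norm_le_half [NormedAddCommGroup E] [InnerProductSpace ℝ E]
    [FiniteDimensional ℝ E] {f : E → E} (hf : Continuous f) (hb : ∀ x, ‖f x‖ ≤ 1 / 2) :
    ∃ x, f x = x := by
  have happrox : ∀ ε : ℝ, 0 < ε → ε ≤ 1 / 4 → ∃ x ∈ closedBall (0 : E) 1, dist (f x) x < ε := by
    intro ε hε hε'
    obtain ⟨g, hg, hgf, -⟩ := hf.exists_contDiff_approx (ε := fun _ => ε) 1 continuous_const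
      (fun _ => hε)
    have hgb : ∀ x, ‖g x‖ ≤ 3 / 4 := fun x => by
      have h1 := hgf x
      rw [dist_eq_norm] at h1
      have h2 := norm_le_norm_add_norm_sub' (g x) (f x)
      linarith [hb x]
    let χ : ContDiffBump (0 : E) := ⟨3 / 4, 1, by norm_num, by norm_num⟩
    obtain ⟨x, hx⟩ := exists_zero_of_eq_id_on_sphere (F := fun x => x - χ x • g x)
      (contDiff_id.sub ((χ.contDiff (n := 1)).smul hg)) (fun x hx => by
        have : χ x = 0 := χ.zero_of_le_dist (by simp [χ, hx])
        simp [this])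
    have hx' : x = χ x • g x := sub_eq_zero.1 hx
    have hxn : ‖x‖ ≤ 3 / 4 := by
      rw [hx', norm_smul, Real.norm_of_nonneg χ.nonneg]
      exact (mul_le_of_le_one_left (norm_nonneg _) χ.le_one).trans (hgb x)
    have hχ : χ x = 1 := χ.one_of_mem_closedBall (by simpa [χ] using hxn)
    rw [hχ, one_smul] at hx'
    refine ⟨x, by simpa using hxn.trans (by norm_num), ?_⟩
    have := hgf x
    rwa [← hx', dist_comm] at this
  obtain ⟨x, -, hx⟩ := (isCompact_closedBall (0 : E) 1).exists_isMinOn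
    ⟨0, by simp⟩ (f := fun x => dist (f x) x) (by fun_prop)
  refine ⟨x, dist_le_zero.1 (le_of_forall_pos_le_add fun ε hε => ?_)⟩
  obtain ⟨y, hy, hlt⟩ := happrox (min ε (1 / 4)) (by positivity) (min_le_right _ _)
  have h1 : dist (f x) x ≤ dist (f y) y := hx hy
  linarith [min_le_left ε (1 / 4)]

/-- **Brouwer's fixed point theorem** for compact retracts of finite-dimensional spaces. -/
theorem exists_fixedPoint_of_retract {X : Type*} [TopologicalSpace X] [CompactSpace X]
    [NormedAddCommGroup E] [NormedSpace ℝ E] [FiniteDimensional ℝ E]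
    {e : X → E} {ρ : E → X} (he : Continuous e) (hρ : Continuous ρ)
    (hρe : Function.LeftInverse ρ e) {f : X → X} (hf : Continuous f) : ∃ x, f x = x := by
  set L := toEuclidean (E := E)
  obtain ⟨C, hC⟩ := (isCompact_range (L.continuous.comp he)).isBounded.exists_norm_le
  have hC' : ∀ x, ‖L (e x)‖ ≤ |C| + 1 := fun x => by
    have := hC _ ⟨x, rfl⟩
    simp only [Function.comp_apply] at this
    linarith [le_abs_self C]
  set c : ℝ := 2 * (|C| + 1)
  have hc : 0 < c := by positivity
  -- rescale so that the conjugated map takes values in the ball of radius `1 / 2`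
  obtain ⟨y, hy⟩ := exists_fixedPoint_of_norm_le_half
    (f := fun y => c⁻¹ • L (e (f (ρ (L.symm (c • y)))))) (by fun_prop) (fun y => by
      rw [norm_smul, norm_inv, Real.norm_of_nonneg hc.le, inv_mul_le_iff₀ hc]
      simpa [c] using (hC' _).trans (by linarith))
  refine ⟨ρ (L.symm (c • y)), ?_⟩
  conv_rhs => rw [← hy, smul_inv_smul₀ hc.ne', L.symm_apply_apply, hρe]

end Brouwer
/-! ### Zeros of orthogonal polynomials on an interval -/

section Orthogonality

/-- A measure of class `M(Δ)` lives on a compact interval inside `Δ`, and no finite set is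
conull. -/
theorem InClass.exists_measure_Icc {Δ : Set ℝ} (hΔ : Δ.OrdConnected) {σ : Measure ℝ}
    (h : InClass Δ σ) : ∃ a b : ℝ, a ≤ b ∧ Set.Icc a b ⊆ Δ ∧ ∃ μ : Measure (Set.Icc a b),
      IsFiniteMeasure μ ∧ (∀ s : Set (Set.Icc a b), s.Finite → μ sᶜ ≠ 0) ∧
      σ = μ.map ((↑) : Set.Icc a b → ℝ) := by
  have hne := h.infinite_support.nonempty
  have hfin := h.finite
  have ha := h.compact_support.sInf_mem hne
  have hb := h.compact_support.sSup_mem hne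
  have hsub : σ.support ⊆ Set.Icc (sInf σ.support) (sSup σ.support) := fun x hx =>
    ⟨csInf_le h.compact_support.bddBelow hx, le_csSup h.compact_support.bddAbove hx⟩
  refine ⟨sInf σ.support, sSup σ.support, (hsub ha).1.trans (hsub ha).2,
    hΔ.out (h.support_subset ha) (h.support_subset hb), ?_⟩
  set I := Set.Icc (sInf σ.support) (sSup σ.support)
  have hemb : MeasurableEmbedding ((↑) : I → ℝ) := MeasurableEmbedding.subtype_coe measurableSet_Icc
  have hae : ∀ᵐ x ∂σ, x ∈ I := by
    filter_upwards [Measure.support_mem_ae (μ := σ)] with x hx using hsub hx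
  have hmap : (σ.comap ((↑) : I → ℝ)).map (↑) = σ := by
    rw [hemb.map_comap, Subtype.range_coe, Measure.restrict_eq_self_of_ae_mem hae]
  refine ⟨σ.comap (↑), ?_, ?_, hmap.symm⟩
  · refine ⟨?_⟩
    rw [← Set.preimage_univ (f := ((↑) : I → ℝ)), ← hemb.map_apply, hmap]
    exact measure_lt_top _ _
  · intro s hs h0
    have hs' : ∀ᵐ x ∂σ, x ∈ ((↑) '' s : Set ℝ) := by
      rw [← hmap, hemb.ae_map_iff]
      filter_upwards [show ∀ᵐ x ∂(σ.comap ((↑) : I → ℝ)), x ∈ s from h0] with x hx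
        using ⟨x, hx, rfl⟩
    exact h.infinite_support ((hs.image _).subset
      (Measure.support_subset_of_isClosed (hs.image _).isClosed hs'))

instance Icc_preconnectedSpace (a b : ℝ) : PreconnectedSpace (Set.Icc a b) :=
  Subtype.preconnectedSpace isPreconnected_Icc

theorem integrable_of_continuous {X : Type*} [TopologicalSpace X] [CompactSpace X]
    [MeasurableSpace X] [BorelSpace X] (μ : Measure X) [IsFiniteMeasure μ] {f : X → ℝ}
    (hf : Continuous f) : Integrable f μ :=
  hf.integrable_of_hasCompactSupport (HasCompactSupport.of_compactSpace f)

theorem pos_or_neg_of_ne_zero {X : Type*} [TopologicalSpace X] [PreconnectedSpace X] {g : X → ℝ}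
    (hg : Continuous g) (h0 : ∀ x, g x ≠ 0) : (∀ x, 0 < g x) ∨ ∀ x, g x < 0 := by
  by_contra! h
  obtain ⟨⟨x, hx⟩, y, hy⟩ := h
  obtain ⟨z, hz⟩ := mem_range_of_exists_le_of_exists_ge hg ⟨x, hx⟩ ⟨y, hy⟩
  exact h0 z hz

/-- The weight `g` has constant sign on the interval, and `P` vanishes only on a finite set, which
is not conull. -/
theorem integral_sq_mul_ne_zero {a b : ℝ} (μ : Measure (Set.Icc a b)) [IsFiniteMeasure μ]
    (hμ : ∀ s : Set (Set.Icc a b), s.Finite → μ sᶜ ≠ 0) {P : ℝ[X]} (hP : P ≠ 0)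
    {g : Set.Icc a b → ℝ} (hg : Continuous g) (h0 : ∀ x, g x ≠ 0) :
    ∫ x, P.eval (x : ℝ) ^ 2 * g x ∂μ ≠ 0 := by
  have key : ∀ g : Set.Icc a b → ℝ, Continuous g → (∀ x, 0 < g x) →
      ∫ x, P.eval (x : ℝ) ^ 2 * g x ∂μ ≠ 0 := by
    intro g hg hpos h
    have hc : Continuous fun x : Set.Icc a b => P.eval (x : ℝ) ^ 2 * g x := by fun_prop
    rw [integral_eq_zero_iff_of_nonneg (fun x => mul_nonneg (sq_nonneg _) (hpos x).le)
      (integrable_of_continuous μ hc)] at h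
    have hfin : {x : Set.Icc a b | P.eval (x : ℝ) = 0}.Finite := by
      refine Set.Finite.preimage Subtype.val_injective.injOn
        ((P.roots.toFinset.finite_toSet).subset fun x (hx : P.eval x = 0) => ?_)
      simpa [hP] using hx
    have hae : ∀ᵐ x : Set.Icc a b ∂μ, P.eval (x : ℝ) = 0 := by
      filter_upwards [h] with x hx
      simpa [(hpos x).ne'] using hx
    exact hμ _ hfin hae
  rcases pos_or_neg_of_ne_zero hg h0 with h | h
  · exact key g hg h
  · intro hz
    refine key (fun x => - g x) hg.neg (fun x => neg_pos.2 (h x)) ?_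
    simp only [mul_neg, integral_neg, hz, neg_zero]

theorem integral_eval_mul_eq_zero {a b : ℝ} {μ : Measure (Set.Icc a b)} [IsFiniteMeasure μ]
    {n : ℕ} {F : Set.Icc a b → ℝ} (hF : Continuous F)
    (h : ∀ k < n, ∫ x, (x : ℝ) ^ k * F x ∂μ = 0) {p : ℝ[X]} (hp : p.degree < n) :
    ∫ x, p.eval (x : ℝ) * F x ∂μ = 0 := by
  rcases eq_or_ne p 0 with rfl | hp0
  · simp
  have hn : p.natDegree < n := (natDegree_lt_iff_degree_lt hp0).2 hp
  simp only [eval_eq_sum_range' hn, Finset.sum_mul, mul_assoc]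
  rw [integral_finsetSum _ fun i _ => integrable_of_continuous μ (by fun_prop)]
  refine Finset.sum_eq_zero fun i hi => ?_
  rw [integral_const_mul, h i (Finset.mem_range.1 hi), mul_zero]

/-- Orthogonality forces zeros: multiplying `T` by the product `P` over its zeros in the interval
turns it into `P²` times a function of constant sign, so `P` cannot have degree below `n`. -/
theorem le_card_roots_of_orthogonal {a b : ℝ} {μ : Measure (Set.Icc a b)} [IsFiniteMeasure μ]
    (hμ : ∀ s : Set (Set.Icc a b), s.Finite → μ sᶜ ≠ 0) {g : Set.Icc a b → ℝ} (hg : Continuous g)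
    (hg0 : ∀ x, g x ≠ 0) {T : ℝ[X]} (hT : T ≠ 0) {n : ℕ}
    (h : ∀ k < n, ∫ x, (x : ℝ) ^ k * (T.eval (x : ℝ) * g x) ∂μ = 0) :
    n ≤ (T.roots.filter (· ∈ Set.Icc a b)).card := by
  classical
  set s := T.roots.filter (· ∈ Set.Icc a b) with hs
  by_contra! hlt
  set P := (s.map fun r => X - C r).prod with hP
  have hPm : P.Monic := monic_multiset_prod_of_monic _ _ fun r _ => monic_X_sub_C r
  have hdvd : P ∣ T :=
    (Multiset.prod_X_sub_C_dvd_iff_le_roots hT s).2 (Multiset.filter_le _ _)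
  obtain ⟨R, hR⟩ := hdvd
  have hroots : T.roots = s + R.roots := by
    rw [hR, roots_mul (hR ▸ hT), hP, roots_multiset_prod_X_sub_C]
  have hR0 : R ≠ 0 := fun h => hT (by rw [hR, h, mul_zero])
  have hRne : ∀ x : Set.Icc a b, R.eval (x : ℝ) ≠ 0 := by
    intro x hx
    have hmem : (x : ℝ) ∈ R.roots.filter (· ∈ Set.Icc a b) :=
      Multiset.mem_filter.2 ⟨(mem_roots hR0).2 hx, x.2⟩
    have hself : s.filter (· ∈ Set.Icc a b) = s :=
      Multiset.filter_eq_self.2 fun r hr => (Multiset.mem_filter.1 hr).2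
    have : s = s + R.roots.filter (· ∈ Set.Icc a b) := by
      conv_lhs => rw [hs, hroots, Multiset.filter_add, hself]
    rw [left_eq_add.1 this] at hmem
    exact Multiset.notMem_zero _ hmem
  have hdeg : P.degree < n := by
    rw [degree_eq_natDegree hPm.ne_zero, hP, natDegree_multiset_prod_X_sub_C_eq_card]
    exact_mod_cast hlt
  have hz := integral_eval_mul_eq_zero (by fun_prop) h hdeg
  refine integral_sq_mul_ne_zero μ hμ hPm.ne_zero (g := fun x => R.eval (x : ℝ) * g x)
    (by fun_prop) (fun x => mul_ne_zero (hRne x) (hg0 x)) ?_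
  rw [← hz]
  refine integral_congr_ae (Filter.Eventually.of_forall fun x => ?_)
  simp only [hR, eval_mul]
  ring

/-- The monic polynomial with the zeros `t i`. -/
noncomputable def nodal {a b : ℝ} {n : ℕ} (t : Fin n → Set.Icc a b) : ℝ[X] :=
  ∏ i, (X - C (t i : ℝ))

section Nodal

variable {a b : ℝ} {n : ℕ} (t : Fin n → Set.Icc a b)

theorem nodal_monic : (nodal t).Monic := monic_prod_of_monic _ _ fun _ _ => monic_X_sub_C _

theorem nodal_natDegree : (nodal t).natDegree = n := by
  rw [nodal, natDegree_prod_of_monic _ _ fun _ _ => monic_X_sub_C _]; simp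

theorem nodal_roots : (nodal t).roots = Finset.univ.val.map fun i => (t i : ℝ) := by
  rw [nodal, ← roots_multiset_prod_X_sub_C (Finset.univ.val.map fun i => (t i : ℝ)),
    Multiset.map_map]
  rfl

theorem eval_nodal (x : ℝ) : (nodal t).eval x = ∏ i, (x - t i) := by
  simp [nodal, eval_prod]

theorem eval_nodal_ne_zero {x : ℝ} (hx : x ∉ Set.Icc a b) : (nodal t).eval x ≠ 0 := by
  rw [eval_nodal]
  exact Finset.prod_ne_zero_iff.2 fun i _ h => hx (sub_eq_zero.1 h ▸ (t i).2)

end Nodal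

/-! ### Angelesco systems -/

variable {ι : Type*} [Fintype ι] {a b : ι → ℝ} {n : ι → ℕ}

/-- The common denominator of the system: the monic polynomial whose zeros are all the points
`t j i`. -/
noncomputable def denom (t : ∀ j, Fin (n j) → Set.Icc (a j) (b j)) : ℝ[X] := ∏ j, nodal (t j)

theorem denom_monic (t : ∀ j, Fin (n j) → Set.Icc (a j) (b j)) : (denom t).Monic :=
  monic_prod_of_monic _ _ fun j _ => nodal_monic (t j)

theorem denom_degree (t : ∀ j, Fin (n j) → Set.Icc (a j) (b j)) :
    (denom t).degree = ((∑ j, n j : ℕ) : WithBot ℕ) := by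
  rw [degree_eq_natDegree (denom_monic t).ne_zero, denom,
    natDegree_prod_of_monic _ _ fun j _ => nodal_monic (t j)]
  simp [nodal_natDegree]

theorem eval_denom (t : ∀ j, Fin (n j) → Set.Icc (a j) (b j)) (x : ℝ) :
    (denom t).eval x = ∏ j, ∏ i, (x - t j i) := by
  simp [denom, eval_prod, eval_nodal]

theorem eval_denom_ne_zero (t : ∀ j, Fin (n j) → Set.Icc (a j) (b j)) {x : ℝ}
    (hx : ∀ j, x ∉ Set.Icc (a j) (b j)) : (denom t).eval x ≠ 0 := by
  rw [denom, eval_prod]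
  exact Finset.prod_ne_zero_iff.2 fun j _ => eval_nodal_ne_zero _ (hx j)

theorem continuous_eval_denom {Y : Type*} [TopologicalSpace Y]
    {t : Y → ∀ j, Fin (n j) → Set.Icc (a j) (b j)} (ht : Continuous t) {f : Y → ℝ}
    (hf : Continuous f) : Continuous fun y => (denom (t y)).eval (f y) := by
  simp only [eval_denom]
  fun_prop

/-- An Angelesco system: finite measures that are not finitely supported, on pairwise disjoint
compact intervals, with continuous zero-free weights. Since the intervals are connected, each
weight has constant sign, and `g j dμ j` is a measure up to sign. -/
structure IsAngelesco (μ : ∀ j, Measure (Set.Icc (a j) (b j)))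
    (g : ∀ j, Set.Icc (a j) (b j) → ℝ) : Prop where
  disjoint : ∀ j k, j ≠ k → Disjoint (Set.Icc (a j) (b j)) (Set.Icc (a k) (b k))
  finite : ∀ j, IsFiniteMeasure (μ j)
  ne_zero : ∀ j, ∀ s : Set (Set.Icc (a j) (b j)), s.Finite → μ j sᶜ ≠ 0
  continuous : ∀ j, Continuous (g j)
  weight_ne_zero : ∀ j x, g j x ≠ 0

/-- Multiple orthogonality of `T`: for each `j` it is orthogonal to the polynomials of degree less
than `n j`, with respect to the measure `g j dμ j`. -/
def IsOrthogonal (n : ι → ℕ) (μ : ∀ j, Measure (Set.Icc (a j) (b j)))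
    (g : ∀ j, Set.Icc (a j) (b j) → ℝ) (T : ℝ[X]) : Prop :=
  ∀ j, ∀ k < n j, ∫ x, (x : ℝ) ^ k * (T.eval (x : ℝ) * g j x) ∂(μ j) = 0

variable {μ : ∀ j, Measure (Set.Icc (a j) (b j))} {g : ∀ j, Set.Icc (a j) (b j) → ℝ}

theorem sum_filter_le_of_disjoint {α : Type*} [DecidableEq α] (m : Multiset α) (I : ι → Set α)
    [∀ j, DecidablePred (· ∈ I j)] (hI : ∀ j k, j ≠ k → Disjoint (I j) (I k)) :
    ∑ j, m.filter (· ∈ I j) ≤ m := by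
  rw [Multiset.le_iff_count]
  intro x
  rw [Multiset.count_sum']
  simp only [Multiset.count_filter]
  by_cases h : ∃ j, x ∈ I j
  · obtain ⟨j, hj⟩ := h
    rw [Finset.sum_eq_single j]
    · simp [hj]
    · intro k _ hk
      rw [if_neg fun hx => (hI k j hk).le_bot ⟨hx, hj⟩]
    · simp
  · push Not at h
    simp [h]

/-- Each interval contains at least `n j` zeros, which already exhausts the degree; hence there is
no room for further zeros or for a smaller degree. -/
theorem IsAngelesco.roots_eq (hA : IsAngelesco μ g) {T : ℝ[X]} (hT : T ≠ 0)
    (hdeg : T.degree ≤ ((∑ j, n j : ℕ) : WithBot ℕ)) (ho : IsOrthogonal n μ g T) :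
    (∀ j, (T.roots.filter (· ∈ Set.Icc (a j) (b j))).card = n j) ∧
      T.roots = ∑ j, T.roots.filter (· ∈ Set.Icc (a j) (b j)) ∧
      T.natDegree = ∑ j, n j ∧ T.roots.card = T.natDegree := by
  classical
  have h1 : ∀ j, n j ≤ (T.roots.filter (· ∈ Set.Icc (a j) (b j))).card := fun j =>
    have := hA.finite j
    le_card_roots_of_orthogonal (hA.ne_zero j) (hA.continuous j) (hA.weight_ne_zero j) hT (ho j)
  have h2 := sum_filter_le_of_disjoint T.roots (fun j => Set.Icc (a j) (b j)) hA.disjoint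
  have h3 := Multiset.card_le_card h2
  rw [Multiset.card_sum] at h3
  have h4 := Finset.sum_le_sum fun j (_ : j ∈ Finset.univ) => h1 j
  have h5 := T.card_roots'
  have h6 : T.natDegree ≤ ∑ j, n j := natDegree_le_iff_degree_le.2 hdeg
  refine ⟨fun j => ?_, (Multiset.eq_of_le_of_card_le h2 ?_).symm, by omega, by omega⟩
  · exact ((Finset.sum_eq_sum_iff_of_le fun j _ => h1 j).1 (by omega) j (Finset.mem_univ j)).symm
  · rw [Multiset.card_sum]; omega

theorem exists_monotone_of_card {α : Type*} [LinearOrder α] {n : ℕ} (s : Multiset α)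
    (hs : s.card = n) : ∃ t : Fin n → α, Monotone t ∧ Finset.univ.val.map t = s := by
  subst hs
  obtain ⟨l, rfl⟩ := Quot.exists_rep s
  refine ⟨l.get ∘ Tuple.sort l.get, Tuple.monotone_sort l.get, ?_⟩
  rw [Fin.univ_val_map]
  refine Multiset.coe_eq_coe.2 ((Equiv.Perm.ofFn_comp_perm (Tuple.sort l.get) l.get).trans ?_)
  rw [List.ofFn_get]

theorem monotone_eq_of_map_eq {α : Type*} [LinearOrder α] {n : ℕ} {t u : Fin n → α}
    (ht : Monotone t) (hu : Monotone u) (h : Finset.univ.val.map t = Finset.univ.val.map u) :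
    t = u := by
  rw [Fin.univ_val_map, Fin.univ_val_map, Multiset.coe_eq_coe] at h
  exact List.ofFn_injective
    (h.eq_of_sortedLE (List.sortedLE_ofFn_iff.2 ht) (List.sortedLE_ofFn_iff.2 hu))

theorem filter_sum_multiset {α κ : Type*} (p : α → Prop) [DecidablePred p] (s : Finset κ)
    (f : κ → Multiset α) : (∑ i ∈ s, f i).filter p = ∑ i ∈ s, (f i).filter p := by
  classical
  induction s using Finset.induction_on with
  | empty => simp
  | insert i s hi ih => rw [Finset.sum_insert hi, Finset.sum_insert hi, Multiset.filter_add, ih]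

theorem filter_roots_denom (hd : ∀ j k, j ≠ k → Disjoint (Set.Icc (a j) (b j)) (Set.Icc (a k) (b k)))
    (t : ∀ j, Fin (n j) → Set.Icc (a j) (b j)) (j : ι) :
    (denom t).roots.filter (· ∈ Set.Icc (a j) (b j)) = Finset.univ.val.map fun i => (t j i : ℝ) := by
  classical
  have hr : (denom t).roots = ∑ k, (nodal (t k)).roots := roots_prod _ _ (denom_monic t).ne_zero
  rw [hr, filter_sum_multiset, Finset.sum_eq_single j]
  · rw [nodal_roots, Multiset.filter_eq_self]
    intro x hx
    obtain ⟨i, -, rfl⟩ := Multiset.mem_map.1 hx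
    exact (t j i).2
  · intro k _ hk
    rw [nodal_roots, Multiset.filter_eq_nil]
    intro x hx hxj
    obtain ⟨i, -, rfl⟩ := Multiset.mem_map.1 hx
    exact (hd k j hk).le_bot ⟨(t k i).2, hxj⟩
  · simp

theorem IsAngelesco.exists_monotone (hA : IsAngelesco μ g) {T : ℝ[X]} (hT : T ≠ 0)
    (hdeg : T.degree ≤ ((∑ j, n j : ℕ) : WithBot ℕ)) (ho : IsOrthogonal n μ g T) :
    ∃ t : ∀ j, Fin (n j) → Set.Icc (a j) (b j), (∀ j, Monotone (t j)) ∧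
      IsOrthogonal n μ g (denom t) := by
  classical
  obtain ⟨hc, hr, hn, hcr⟩ := hA.roots_eq hT hdeg ho
  choose t ht hts using fun j => exists_monotone_of_card _ (hc j)
  have hmem : ∀ j i, t j i ∈ Set.Icc (a j) (b j) := by
    intro j i
    have : t j i ∈ Finset.univ.val.map (t j) := Multiset.mem_map_of_mem _ (Finset.mem_univ i)
    rw [hts j] at this
    exact (Multiset.mem_filter.1 this).2
  refine ⟨fun j i => ⟨t j i, hmem j i⟩, fun j i i' h => ht j h, ?_⟩
  have hT' : T = C T.leadingCoeff * denom fun j i => ⟨t j i, hmem j i⟩ := by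
    conv_lhs => rw [← C_leadingCoeff_mul_prod_multiset_X_sub_C hcr, hr]
    congr 1
    rw [← Multiset.coe_mapAddMonoidHom, map_sum, Multiset.prod_sum]
    refine Finset.prod_congr rfl fun j _ => ?_
    rw [Multiset.coe_mapAddMonoidHom, ← hts j, Multiset.map_map]
    rfl
  intro j k hk
  have h := ho j k hk
  rw [hT'] at h
  simp only [eval_mul, eval_C] at h
  have : ∀ x : Set.Icc (a j) (b j), (x : ℝ) ^ k * (T.leadingCoeff *
      (denom fun j i => (⟨t j i, hmem j i⟩ : Set.Icc (a j) (b j))).eval (x : ℝ) * g j x) =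
      T.leadingCoeff * ((x : ℝ) ^ k * ((denom fun j i =>
        (⟨t j i, hmem j i⟩ : Set.Icc (a j) (b j))).eval (x : ℝ) * g j x)) := fun x => by ring
  simp only [this, integral_const_mul] at h
  exact (mul_eq_zero.1 h).resolve_left (leadingCoeff_ne_zero.2 hT)

/-- The difference of two monic solutions would have too small a degree for `roots_eq`; recording
the zeros in increasing order removes the remaining ambiguity. -/
theorem IsAngelesco.eq_of_orthogonal (hA : IsAngelesco μ g)
    {t u : ∀ j, Fin (n j) → Set.Icc (a j) (b j)} (htm : ∀ j, Monotone (t j))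
    (hum : ∀ j, Monotone (u j)) (ht : IsOrthogonal n μ g (denom t))
    (hu : IsOrthogonal n μ g (denom u)) : t = u := by
  have heq : denom t = denom u := by
    by_contra hne
    have hD : denom t - denom u ≠ 0 := sub_ne_zero.2 hne
    have hlt : (denom t - denom u).degree < ((∑ j, n j : ℕ) : WithBot ℕ) := by
      rw [← denom_degree t]
      exact degree_sub_lt_left (by rw [denom_degree, denom_degree]) (denom_monic t).ne_zero
        (by rw [(denom_monic t).leadingCoeff, (denom_monic u).leadingCoeff])
    have ho : IsOrthogonal n μ g (denom t - denom u) := by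
      intro j k hk
      have := hA.finite j
      have := hA.continuous j
      simp only [eval_sub, sub_mul, mul_sub]
      rw [integral_sub (integrable_of_continuous _ (by fun_prop))
        (integrable_of_continuous _ (by fun_prop)), ht j k hk, hu j k hk, sub_zero]
    have := (hA.roots_eq hD hlt.le ho).2.2.1
    rw [degree_eq_natDegree hD, this] at hlt
    exact lt_irrefl _ hlt
  funext j
  have h1 := filter_roots_denom hA.disjoint t j
  rw [heq, filter_roots_denom hA.disjoint u j] at h1
  have := monotone_eq_of_map_eq (t := fun i => (u j i : ℝ)) (u := fun i => (t j i : ℝ))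
    (fun i i' h => hum j h) (fun i i' h => htm j h) h1
  funext i
  exact Subtype.ext (congrFun this i).symm

/-- The orthogonality relations are `∑ n j` homogeneous linear equations for `∑ n j + 1`
coefficients. -/
theorem IsAngelesco.exists_orthogonal (hA : IsAngelesco μ g) (n : ι → ℕ) :
    ∃ T : ℝ[X], T ≠ 0 ∧ T.degree ≤ ((∑ j, n j : ℕ) : WithBot ℕ) ∧ IsOrthogonal n μ g T := by
  set N := ∑ j, n j
  have hint : ∀ j k (T : ℝ[X]),
      Integrable (fun x : Set.Icc (a j) (b j) => (x : ℝ) ^ k * (T.eval (x : ℝ) * g j x)) (μ j) :=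
    fun j k T => by
      have := hA.finite j
      have := hA.continuous j
      exact integrable_of_continuous _ (by fun_prop)
  let L : degreeLT ℝ (N + 1) →ₗ[ℝ] ((Σ j, Fin (n j)) → ℝ) :=
    { toFun := fun T s => ∫ x, (x : ℝ) ^ (s.2 : ℕ) * ((T : ℝ[X]).eval (x : ℝ) * g s.1 x) ∂(μ s.1)
      map_add' := fun T U => by
        funext s
        simp only [Submodule.coe_add, eval_add, add_mul, mul_add, Pi.add_apply]
        exact integral_add (hint _ _ _) (hint _ _ _)
      map_smul' := fun c T => by
        funext s
        simp only [Submodule.coe_smul, eval_smul, smul_eq_mul, RingHom.id_apply, Pi.smul_apply]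
        rw [← integral_const_mul]
        refine integral_congr_ae (Filter.Eventually.of_forall fun x => ?_)
        simp only
        ring }
  have hfin : FiniteDimensional ℝ (degreeLT ℝ (N + 1)) :=
    (degreeLTEquiv ℝ (N + 1)).symm.finiteDimensional
  have hker := LinearMap.ker_ne_bot_of_finrank_lt (f := L) (by
    rw [(degreeLTEquiv ℝ (N + 1)).finrank_eq]
    simp [N])
  obtain ⟨T, hT, hT0⟩ := Submodule.exists_mem_ne_zero_of_ne_bot hker
  refine ⟨T, fun h => hT0 (Subtype.ext h), ?_, fun j k hk => ?_⟩
  · have := mem_degreeLT.1 T.2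
    exact natDegree_le_iff_degree_le.1 (Nat.lt_succ_iff.1
      ((natDegree_lt_iff_degree_lt fun h => hT0 (Subtype.ext h)).2 this))
  · exact congrFun (LinearMap.mem_ker.1 hT) ⟨j, ⟨k, hk⟩⟩

/-- The closed graph theorem for maps into a compact space. -/
theorem continuous_of_isClosed_of_unique {X Y : Type*} [TopologicalSpace X] [TopologicalSpace Y]
    [CompactSpace Y] {R : Set (X × Y)} (hR : IsClosed R) {τ : X → Y} (hτ : ∀ x, (x, τ x) ∈ R)
    (hu : ∀ x y, (x, y) ∈ R → y = τ x) : Continuous τ := by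
  refine continuous_iff_isClosed.2 fun C hC => ?_
  have : τ ⁻¹' C = Prod.fst '' (R ∩ Prod.snd ⁻¹' C) := by
    ext x
    constructor
    · exact fun hx => ⟨(x, τ x), ⟨hτ x, hx⟩, rfl⟩
    · rintro ⟨⟨x, y⟩, ⟨hxy, hy⟩, rfl⟩
      rw [Set.mem_preimage, ← hu x y hxy]
      exact hy
  rw [this]
  exact isClosedMap_fst_of_compactSpace _ (hR.inter (hC.preimage continuous_snd))

theorem continuous_integral_of_continuous {X Y : Type*} [TopologicalSpace X]
    [FirstCountableTopology X] [LocallyCompactSpace X] [TopologicalSpace Y] [CompactSpace Y]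
    [MeasurableSpace Y] [BorelSpace Y] (μ : Measure Y) [IsFiniteMeasure μ] {f : X → Y → ℝ}
    (hf : Continuous f.uncurry) : Continuous fun x => ∫ y, f x y ∂μ := by
  simpa using continuous_parametric_integral_of_continuous (μ := μ) hf isCompact_univ

/-- The zeros of the multiple orthogonal polynomial depend continuously on the weights: the
solution is unique and ranges over a compact space, so its closed graph suffices. -/
theorem exists_continuous_zeros {X : Type*} [TopologicalSpace X] [FirstCountableTopology X]
    [LocallyCompactSpace X] (n : ι → ℕ) {g : X → ∀ j, Set.Icc (a j) (b j) → ℝ}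
    (hA : ∀ x, IsAngelesco μ (g x))
    (hg : ∀ j, Continuous (Function.uncurry fun x => g x j)) :
    ∃ τ : X → ∀ j, Fin (n j) → Set.Icc (a j) (b j), Continuous τ ∧
      ∀ x, IsOrthogonal n μ (g x) (denom (τ x)) := by
  have hex : ∀ x, ∃ t : ∀ j, Fin (n j) → Set.Icc (a j) (b j), (∀ j, Monotone (t j)) ∧
      IsOrthogonal n μ (g x) (denom t) := fun x => by
    obtain ⟨T, hT, hdeg, ho⟩ := (hA x).exists_orthogonal n
    exact (hA x).exists_monotone hT hdeg ho
  choose τ hτ using hex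
  refine ⟨τ, ?_, fun x => (hτ x).2⟩
  have hmono : IsClosed {p : X × (∀ j, Fin (n j) → Set.Icc (a j) (b j)) |
      ∀ j, Monotone (p.2 j)} := by
    simp only [Monotone, Set.ofPred_forall]
    refine isClosed_iInter fun j => isClosed_iInter fun i => isClosed_iInter fun i' =>
      isClosed_iInter fun _ => isClosed_le ?_ ?_
    · exact (continuous_apply i).comp ((continuous_apply j).comp continuous_snd)
    · exact (continuous_apply i').comp ((continuous_apply j).comp continuous_snd)
  have horth : IsClosed {p : X × (∀ j, Fin (n j) → Set.Icc (a j) (b j)) |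
      IsOrthogonal n μ (g p.1) (denom p.2)} := by
    simp only [IsOrthogonal, Set.ofPred_forall]
    refine isClosed_iInter fun j => isClosed_iInter fun k => isClosed_iInter fun _ =>
      isClosed_eq ?_ continuous_const
    rcases isEmpty_or_nonempty X with hX | ⟨⟨x₀⟩⟩
    · exact continuous_iff_continuousAt.2 fun p => isEmptyElim p.1
    have := (hA x₀).finite j
    refine continuous_integral_of_continuous (μ j)
      (f := fun (p : X × (∀ j, Fin (n j) → Set.Icc (a j) (b j))) x =>
        (x : ℝ) ^ k * ((denom p.2).eval (x : ℝ) * g p.1 j x)) ?_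
    have h1 := hg j
    have h2 : Continuous fun q : (X × (∀ j, Fin (n j) → Set.Icc (a j) (b j))) ×
        Set.Icc (a j) (b j) => (denom q.1.2).eval (q.2 : ℝ) :=
      continuous_eval_denom (by fun_prop) (by fun_prop)
    have h3 : Continuous fun q : (X × (∀ j, Fin (n j) → Set.Icc (a j) (b j))) ×
        Set.Icc (a j) (b j) => g q.1.1 j q.2 :=
      h1.comp ((continuous_fst.comp continuous_fst).prodMk continuous_snd)
    have h4 : Continuous fun q : (X × (∀ j, Fin (n j) → Set.Icc (a j) (b j))) ×
        Set.Icc (a j) (b j) => (q.2 : ℝ) ^ k := by fun_prop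
    exact h4.mul (h2.mul h3)
  exact continuous_of_isClosed_of_unique (hmono.inter horth) hτ
    fun x y hy => (hA x).eq_of_orthogonal hy.1 (hτ x).1 hy.2 (hτ x).2

end Orthogonality
/-! ### The remainder of the interpolation problem -/

section Remainder

/-- The expansion of the divided difference of `p` in powers of `z`: its coefficients are the
iterated quotients `divX`. -/
theorem eval_sub_eval_eq_sum_divX {d : ℕ} {p : ℝ[X]} (hp : p.natDegree ≤ d) (z x : ℝ) :
    p.eval z - p.eval x = (z - x) * ∑ i ∈ Finset.range d, z ^ i * (divX^[i + 1] p).eval x := by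
  induction d generalizing p with
  | zero =>
    rw [eq_C_of_natDegree_le_zero hp]
    simp
  | succ d ih =>
    have h := ih (p := divX p) (by rw [natDegree_divX_eq_natDegree_tsub_one]; omega)
    rw [Finset.sum_range_succ']
    simp only [Function.iterate_succ_apply, Function.iterate_zero, id, pow_zero, one_mul] at h ⊢
    have hs : ∑ i ∈ Finset.range d, z ^ (i + 1) * (divX^[i] p.divX.divX).eval x
        = z * ∑ i ∈ Finset.range d, z ^ i * (divX^[i] p.divX.divX).eval x := by
      rw [Finset.mul_sum]
      exact Finset.sum_congr rfl fun i _ => by ring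
    rw [hs]
    have hz : ∀ y, p.eval y = y * p.divX.eval y + p.coeff 0 := fun y => by
      simpa only [eval_add, eval_mul, eval_X, eval_C] using
        congrArg (eval y) (X_mul_divX_add p).symm
    rw [hz z, hz x]
    linear_combination z * h

theorem natDegree_iterate_divX (p : ℝ[X]) (i : ℕ) :
    (divX^[i] p).natDegree = p.natDegree - i := by
  induction i with
  | zero => simp
  | succ i ih =>
    rw [Function.iterate_succ_apply', natDegree_divX_eq_natDegree_tsub_one, ih]
    omega

theorem degree_iterate_divX_lt {p : ℝ[X]} {i n : ℕ} (h : p.natDegree ≤ i + n) (hn : 0 < n) :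
    (divX^[i + 1] p).degree < n := by
  refine degree_le_natDegree.trans_lt ?_
  rw [natDegree_iterate_divX]
  exact_mod_cast (by omega : p.natDegree - (i + 1) < n)

variable {a b : ℝ} {μ : Measure (Set.Icc a b)} [IsFiniteMeasure μ] {T W : ℝ[X]} {n : ℕ}

theorem sub_ne_zero_of_notMem {z : ℝ} (hz : z ∉ Set.Icc a b) (x : Set.Icc a b) : z - x ≠ 0 :=
  fun h => hz (sub_eq_zero.1 h ▸ x.2)

/-- Multiplying the Cauchy integral by `Q` outside or inside the integral makes no difference,
since the divided difference of `Q` is orthogonal to `T / W`. -/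
theorem eval_mul_integral_cauchy (hW : ∀ x : Set.Icc a b, W.eval (x : ℝ) ≠ 0)
    (ho : ∀ k < n, ∫ x, (x : ℝ) ^ k * (T.eval (x : ℝ) * (1 / W.eval (x : ℝ))) ∂μ = 0)
    {Q : ℝ[X]} (hQ : Q.natDegree ≤ n) {z : ℝ} (hz : z ∉ Set.Icc a b) :
    Q.eval z * ∫ x : Set.Icc a b, T.eval (x : ℝ) / (W.eval (x : ℝ) * (z - x)) ∂μ
      = ∫ x : Set.Icc a b, T.eval (x : ℝ) * Q.eval (x : ℝ) / (W.eval (x : ℝ) * (z - x)) ∂μ := by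
  have hz' := sub_ne_zero_of_notMem hz
  have hF : Continuous fun x : Set.Icc a b => T.eval (x : ℝ) * (1 / W.eval (x : ℝ)) := by
    fun_prop (disch := assumption)
  have hden : ∀ x : Set.Icc a b, W.eval (x : ℝ) * (z - x) ≠ 0 := fun x => mul_ne_zero (hW x) (hz' x)
  rw [← integral_const_mul, ← sub_eq_zero, ← integral_sub
    (integrable_of_continuous μ (by fun_prop (disch := assumption)))
    (integrable_of_continuous μ (by fun_prop (disch := assumption)))]
  have hpt : ∀ x : Set.Icc a b, Q.eval z * (T.eval (x : ℝ) / (W.eval (x : ℝ) * (z - x))) -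
      T.eval (x : ℝ) * Q.eval (x : ℝ) / (W.eval (x : ℝ) * (z - x)) =
      ∑ i ∈ Finset.range n, z ^ i *
        ((divX^[i + 1] Q).eval (x : ℝ) * (T.eval (x : ℝ) * (1 / W.eval (x : ℝ)))) := by
    intro x
    have h := eval_sub_eval_eq_sum_divX hQ z x
    have h1 : ∑ i ∈ Finset.range n, z ^ i *
        ((divX^[i + 1] Q).eval (x : ℝ) * (T.eval (x : ℝ) * (1 / W.eval (x : ℝ)))) =
        (∑ i ∈ Finset.range n, z ^ i * (divX^[i + 1] Q).eval (x : ℝ)) *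
          (T.eval (x : ℝ) * (1 / W.eval (x : ℝ))) := by
      rw [Finset.sum_mul]
      exact Finset.sum_congr rfl fun i _ => by ring
    rw [h1]
    have := hW x
    have := hz' x
    field_simp
    linear_combination T.eval (x : ℝ) * h
  rw [integral_congr_ae (Filter.Eventually.of_forall hpt), integral_finsetSum _ fun i _ =>
    integrable_of_continuous μ (by fun_prop)]
  refine Finset.sum_eq_zero fun i hi => ?_
  have hi := Finset.mem_range.1 hi
  rw [integral_const_mul, integral_eval_mul_eq_zero hF ho
    (degree_iterate_divX_lt (by omega) (by omega)), mul_zero]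

/-- If `T / W` is orthogonal to the polynomials of degree less than `n`, the function
`T σ̂ - W ∫ T / (W (z - x)) dσ` is a polynomial whose degree, a priori less than `deg W`, drops by
`n`. -/
theorem exists_numerator {M : ℕ} (hW : ∀ x : Set.Icc a b, W.eval (x : ℝ) ≠ 0)
    (ho : ∀ k < n, ∫ x, (x : ℝ) ^ k * (T.eval (x : ℝ) * (1 / W.eval (x : ℝ))) ∂μ = 0)
    (hTM : T.natDegree ≤ M) (hWM : W.natDegree ≤ M + n) :
    ∃ S : ℝ[X], S.degree < M ∧ ∀ z ∉ Set.Icc a b,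
      T.eval z * (∫ x : Set.Icc a b, 1 / (z - x) ∂μ) - S.eval z
        = W.eval z * ∫ x : Set.Icc a b, T.eval (x : ℝ) / (W.eval (x : ℝ) * (z - x)) ∂μ := by
  set F : Set.Icc a b → ℝ := fun x => T.eval (x : ℝ) * (1 / W.eval (x : ℝ)) with hFdef
  have hF : Continuous F := by
    simp only [hFdef]
    fun_prop (disch := assumption)
  refine ⟨∑ i ∈ Finset.range M, C (∫ x : Set.Icc a b, (divX^[i + 1] T).eval (x : ℝ) ∂μ -
    ∫ x : Set.Icc a b, (divX^[i + 1] W).eval (x : ℝ) * F x ∂μ) * X ^ i, ?_, fun z hz => ?_⟩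
  · refine (degree_sum_le _ _).trans_lt ((Finset.sup_lt_iff (WithBot.bot_lt_coe M)).2 ?_)
    intro i hi
    exact (degree_C_mul_X_pow_le i _).trans_lt (Nat.cast_lt.2 (Finset.mem_range.1 hi))
  have hz' := sub_ne_zero_of_notMem hz
  have hden : ∀ x : Set.Icc a b, W.eval (x : ℝ) * (z - x) ≠ 0 := fun x => mul_ne_zero (hW x) (hz' x)
  rw [sub_eq_iff_eq_add, ← sub_eq_iff_eq_add', ← integral_const_mul, ← integral_const_mul,
    ← integral_sub
    (integrable_of_continuous μ (by fun_prop (disch := assumption)))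
    (integrable_of_continuous μ (by fun_prop (disch := assumption)))]
  have hpt : ∀ x : Set.Icc a b, T.eval z * (1 / (z - x)) -
      W.eval z * (T.eval (x : ℝ) / (W.eval (x : ℝ) * (z - x))) =
      ∑ i ∈ Finset.range M, z ^ i * (divX^[i + 1] T).eval (x : ℝ) -
      ∑ i ∈ Finset.range (M + n), z ^ i * ((divX^[i + 1] W).eval (x : ℝ) * F x) := by
    intro x
    have h1 := eval_sub_eval_eq_sum_divX hTM z x
    have h2 := eval_sub_eval_eq_sum_divX hWM z x
    have h3 : ∑ i ∈ Finset.range (M + n), z ^ i * ((divX^[i + 1] W).eval (x : ℝ) * F x) =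
        (∑ i ∈ Finset.range (M + n), z ^ i * (divX^[i + 1] W).eval (x : ℝ)) * F x := by
      rw [Finset.sum_mul]
      exact Finset.sum_congr rfl fun i _ => by ring
    rw [h3]
    have := hW x
    have := hz' x
    simp only [hFdef]
    field_simp
    linear_combination W.eval (x : ℝ) * h1 - T.eval (x : ℝ) * h2
  have hi1 : ∀ i, Integrable (fun x : Set.Icc a b => z ^ i * (divX^[i + 1] T).eval (x : ℝ)) μ :=
    fun i => integrable_of_continuous μ (by fun_prop)
  have hi2 : ∀ i, Integrable
      (fun x : Set.Icc a b => z ^ i * ((divX^[i + 1] W).eval (x : ℝ) * F x)) μ :=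
    fun i => integrable_of_continuous μ (by fun_prop)
  rw [integral_congr_ae (Filter.Eventually.of_forall hpt),
    integral_sub (integrable_finsetSum _ fun i _ => hi1 i) (integrable_finsetSum _ fun i _ => hi2 i),
    integral_finsetSum _ fun i _ => hi1 i, integral_finsetSum _ fun i _ => hi2 i,
    Finset.sum_range_add]
  -- the powers `z ^ i` with `i ≥ M` drop out by orthogonality
  have hzero : ∑ i ∈ Finset.range n,
      ∫ x : Set.Icc a b, z ^ (M + i) * ((divX^[M + i + 1] W).eval (x : ℝ) * F x) ∂μ = 0 := by
    refine Finset.sum_eq_zero fun i hi => ?_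
    have hi := Finset.mem_range.1 hi
    rw [integral_const_mul, integral_eval_mul_eq_zero hF ho
      (degree_iterate_divX_lt (by omega) (by omega)), mul_zero]
  rw [hzero, add_zero, eval_finsetSum, ← Finset.sum_sub_distrib]
  refine Finset.sum_congr rfl fun i _ => ?_
  simp only [integral_const_mul, eval_mul, eval_C, eval_pow, eval_X]
  ring

end Remainder

/-! ### The fixed point argument -/

section FixedPoint

variable {ι : Type*} {a b : ι → ℝ} {a₀ b₀ : ℝ} {n N : ι → ℕ}

theorem notMem_Icc_left (hd₀ : ∀ j, Disjoint (Set.Icc a₀ b₀) (Set.Icc (a j) (b j))) (j : ι)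
    (x : Set.Icc (a j) (b j)) : (x : ℝ) ∉ Set.Icc a₀ b₀ := fun h => (hd₀ j).le_bot ⟨h, x.2⟩

theorem notMem_Icc_right (hd₀ : ∀ j, Disjoint (Set.Icc a₀ b₀) (Set.Icc (a j) (b j))) (j : ι)
    (x : Set.Icc a₀ b₀) : (x : ℝ) ∉ Set.Icc (a j) (b j) := fun h => (hd₀ j).le_bot ⟨x.2, h⟩

variable [Fintype ι]

/-- The Cauchy integral `∫ T Q_j / W_j · dμ_j(x) / (z - x)`, where `T` is the common denominator,
`Q_j` its factor with zeros `t j`, and `W_j` the polynomial with zeros `w j`. -/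
noncomputable def cauchyIntegral (μ : ∀ j, Measure (Set.Icc (a j) (b j)))
    (t : ∀ j, Fin (n j) → Set.Icc (a j) (b j)) (w : ∀ j, Fin (N j) → Set.Icc a₀ b₀) (j : ι)
    (z : ℝ) : ℝ :=
  ∫ x : Set.Icc (a j) (b j), (denom t).eval (x : ℝ) * (nodal (t j)).eval (x : ℝ) /
    ((nodal (w j)).eval (x : ℝ) * (z - x)) ∂(μ j)

/-- The integrand is `Q_j²` times a function without zeros on the interval of `μ j`. -/
theorem cauchyIntegral_ne_zero {μ : ∀ j, Measure (Set.Icc (a j) (b j))}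
    (hμ : ∀ j, IsFiniteMeasure (μ j))
    (hμ0 : ∀ j, ∀ s : Set (Set.Icc (a j) (b j)), s.Finite → μ j sᶜ ≠ 0)
    (hd : ∀ j k, j ≠ k → Disjoint (Set.Icc (a j) (b j)) (Set.Icc (a k) (b k)))
    (hd₀ : ∀ j, Disjoint (Set.Icc a₀ b₀) (Set.Icc (a j) (b j)))
    (t : ∀ j, Fin (n j) → Set.Icc (a j) (b j)) (w : ∀ j, Fin (N j) → Set.Icc a₀ b₀) (j : ι)
    (z : Set.Icc a₀ b₀) : cauchyIntegral μ t w j z ≠ 0 := by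
  classical
  have := hμ j
  have hW : ∀ x : Set.Icc (a j) (b j), (nodal (w j)).eval (x : ℝ) ≠ 0 := fun x =>
    eval_nodal_ne_zero _ (notMem_Icc_left hd₀ j x)
  have hz := sub_ne_zero_of_notMem (notMem_Icc_right hd₀ j z)
  have hden : ∀ x : Set.Icc (a j) (b j), (nodal (w j)).eval (x : ℝ) * (z - x) ≠ 0 :=
    fun x => mul_ne_zero (hW x) (hz x)
  set R : ℝ[X] := ∏ k ∈ Finset.univ.erase j, nodal (t k)
  have hR : ∀ x : Set.Icc (a j) (b j), R.eval (x : ℝ) ≠ 0 := fun x => by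
    rw [eval_prod]
    exact Finset.prod_ne_zero_iff.2 fun k hk => eval_nodal_ne_zero _ fun h =>
      (hd k j (Finset.ne_of_mem_erase hk)).le_bot ⟨h, x.2⟩
  have hT : denom t = nodal (t j) * R := (Finset.mul_prod_erase _ _ (Finset.mem_univ j)).symm
  have key := integral_sq_mul_ne_zero (μ j) (hμ0 j) (nodal_monic (t j)).ne_zero
    (g := fun x => R.eval (x : ℝ) / ((nodal (w j)).eval (x : ℝ) * (z - x)))
    (by fun_prop (disch := assumption)) (fun x => div_ne_zero (hR x) (hden x))
  rw [cauchyIntegral]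
  convert key using 3 with x
  rw [hT, eval_mul]
  ring

theorem continuous_eval_nodal {Y : Type*} [TopologicalSpace Y] {c d : ℝ} {k : ℕ}
    {t : Y → Fin k → Set.Icc c d} (ht : Continuous t) {f : Y → ℝ}
    (hf : Continuous f) : Continuous fun y => (nodal (t y)).eval (f y) := by
  simp only [eval_nodal]
  fun_prop

theorem continuous_cauchyIntegral {μ : ∀ j, Measure (Set.Icc (a j) (b j))}
    (hμ : ∀ j, IsFiniteMeasure (μ j))
    (hd₀ : ∀ j, Disjoint (Set.Icc a₀ b₀) (Set.Icc (a j) (b j))) (j : ι) :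
    Continuous fun p : ((∀ j, Fin (n j) → Set.Icc (a j) (b j)) × (∀ j, Fin (N j) → Set.Icc a₀ b₀)) ×
      Set.Icc a₀ b₀ => cauchyIntegral μ p.1.1 p.1.2 j p.2 := by
  have := hμ j
  refine continuous_integral_of_continuous (μ j) ?_
  refine Continuous.div ?_ ?_ ?_
  · refine (continuous_eval_denom (by fun_prop) (by fun_prop)).mul
      (continuous_eval_nodal ?_ (by fun_prop))
    exact (continuous_apply j).comp (by fun_prop)
  · refine (continuous_eval_nodal ?_ (by fun_prop)).mul (by fun_prop)
    exact (continuous_apply j).comp (by fun_prop)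
  · rintro ⟨p, x⟩
    exact mul_ne_zero (eval_nodal_ne_zero _ (notMem_Icc_left hd₀ j x))
      (sub_ne_zero_of_notMem (notMem_Icc_right hd₀ j p.2) x)

theorem continuous_cauchyIntegral_right {μ : ∀ j, Measure (Set.Icc (a j) (b j))}
    (hμ : ∀ j, IsFiniteMeasure (μ j))
    (hd₀ : ∀ j, Disjoint (Set.Icc a₀ b₀) (Set.Icc (a j) (b j)))
    (t : ∀ j, Fin (n j) → Set.Icc (a j) (b j)) (w : ∀ j, Fin (N j) → Set.Icc a₀ b₀) (j : ι) :
    Continuous fun z : Set.Icc a₀ b₀ => cauchyIntegral μ t w j z := by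
  have h1 : Continuous fun z : Set.Icc a₀ b₀ => ((t, w), z) := Continuous.prodMk_right (t, w)
  have h2 := continuous_cauchyIntegral (n := n) (N := N) hμ hd₀ j
  have h3 := h2.comp h1
  exact h3

/-- The space of zeros is a retract of a finite-dimensional space, by truncating coordinates, so
Brouwer's theorem applies to it. -/
theorem exists_fixedPoint_zeros (hab : ∀ j, a j ≤ b j) (hab₀ : a₀ ≤ b₀)
    {f : (∀ j, Fin (n j) → Set.Icc (a j) (b j)) × (∀ j, Fin (N j) → Set.Icc a₀ b₀) →
      (∀ j, Fin (n j) → Set.Icc (a j) (b j)) × (∀ j, Fin (N j) → Set.Icc a₀ b₀)}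
    (hf : Continuous f) : ∃ p, f p = p := by
  refine exists_fixedPoint_of_retract
    (E := (∀ j, Fin (n j) → ℝ) × (∀ j, Fin (N j) → ℝ))
    (e := fun p => (fun j i => (p.1 j i : ℝ), fun j i => (p.2 j i : ℝ)))
    (ρ := fun q => (fun j i => Set.projIcc (a j) (b j) (hab j) (q.1 j i),
      fun j i => Set.projIcc a₀ b₀ hab₀ (q.2 j i))) ?_ ?_ ?_ hf
  · fun_prop
  · refine Continuous.prodMk ?_ ?_
    · exact continuous_pi fun j => continuous_pi fun i => continuous_projIcc.comp (by fun_prop)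
    · exact continuous_pi fun j => continuous_pi fun i => continuous_projIcc.comp (by fun_prop)
  · intro p
    simp

/-- The zeros of an ordinary orthogonal polynomial depend continuously on the weight: a single
interval is an Angelesco system indexed by `Unit`. -/
theorem exists_continuous_zeros_single {X : Type*} [TopologicalSpace X] [FirstCountableTopology X]
    [LocallyCompactSpace X] {c d : ℝ} {μ : Measure (Set.Icc c d)} [IsFiniteMeasure μ]
    (hμ : ∀ s : Set (Set.Icc c d), s.Finite → μ sᶜ ≠ 0) (k : ℕ) {g : X → Set.Icc c d → ℝ}
    (hg : Continuous (Function.uncurry g)) (hg0 : ∀ p z, g p z ≠ 0) :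
    ∃ ω : X → Fin k → Set.Icc c d, Continuous ω ∧ ∀ p, ∀ i < k,
      ∫ z : Set.Icc c d, (z : ℝ) ^ i * ((nodal (ω p)).eval (z : ℝ) * g p z) ∂μ = 0 := by
  obtain ⟨ω, hωc, hω⟩ := exists_continuous_zeros (ι := Unit) (a := fun _ => c) (b := fun _ => d)
    (μ := fun _ => μ) (fun _ => k) (g := fun p _ => g p)
    (fun p => ⟨fun j k h => absurd rfl h, fun _ => inferInstance, fun _ => hμ,
      fun _ => hg.comp (Continuous.prodMk_right p), fun _ z => hg0 p z⟩)
    (fun _ => hg)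
  refine ⟨fun p => ω p (), (continuous_apply ()).comp hωc, fun p i hi => ?_⟩
  have h := hω p () i hi
  have hden : denom (ω p) = nodal (ω p ()) := by simp [denom]
  rwa [hden] at h

/-- The coupled orthogonality relations behind the approximant. The polynomial `T` is multiple
orthogonal for the weights `1 / W_j`, and each `W_j` is orthogonal on the interval of `σ₀` for the
weight formed with the resulting remainder; a solution is a fixed point of the map that solves
each relation with the other zeros frozen. -/
theorem exists_coupled_orthogonal (hab : ∀ j, a j ≤ b j) (hab₀ : a₀ ≤ b₀)
    {μ : ∀ j, Measure (Set.Icc (a j) (b j))} (hμ : ∀ j, IsFiniteMeasure (μ j))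
    (hμ0 : ∀ j, ∀ s : Set (Set.Icc (a j) (b j)), s.Finite → μ j sᶜ ≠ 0)
    {μ₀ : Measure (Set.Icc a₀ b₀)} [IsFiniteMeasure μ₀]
    (hμ₀ : ∀ s : Set (Set.Icc a₀ b₀), s.Finite → μ₀ sᶜ ≠ 0)
    (hd : ∀ j k, j ≠ k → Disjoint (Set.Icc (a j) (b j)) (Set.Icc (a k) (b k)))
    (hd₀ : ∀ j, Disjoint (Set.Icc a₀ b₀) (Set.Icc (a j) (b j))) (n N : ι → ℕ) :
    ∃ (t : ∀ j, Fin (n j) → Set.Icc (a j) (b j)) (w : ∀ j, Fin (N j) → Set.Icc a₀ b₀),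
      (∀ j, ∀ k < n j, ∫ x : Set.Icc (a j) (b j), (x : ℝ) ^ k *
        ((denom t).eval (x : ℝ) * (1 / (nodal (w j)).eval (x : ℝ))) ∂(μ j) = 0) ∧
      ∀ j, ∀ k < N j, ∫ z : Set.Icc a₀ b₀, (z : ℝ) ^ k * ((nodal (w j)).eval (z : ℝ) *
        (cauchyIntegral μ t w j z / ((denom t).eval (z : ℝ) * (nodal (t j)).eval (z : ℝ)))) ∂μ₀
        = 0 := by
  have hW : ∀ (w : ∀ j, Fin (N j) → Set.Icc a₀ b₀) j (x : Set.Icc (a j) (b j)),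
      (nodal (w j)).eval (x : ℝ) ≠ 0 := fun w j x =>
    eval_nodal_ne_zero _ (notMem_Icc_left hd₀ j x)
  have hTQ : ∀ (t : ∀ j, Fin (n j) → Set.Icc (a j) (b j)) j (z : Set.Icc a₀ b₀),
      (denom t).eval (z : ℝ) * (nodal (t j)).eval (z : ℝ) ≠ 0 := fun t j z =>
    mul_ne_zero (eval_denom_ne_zero t fun j => notMem_Icc_right hd₀ j z)
      (eval_nodal_ne_zero _ (notMem_Icc_right hd₀ j z))
  have hg : ∀ j, Continuous (Function.uncurry fun
      (p : (∀ j, Fin (n j) → Set.Icc (a j) (b j)) × (∀ j, Fin (N j) → Set.Icc a₀ b₀))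
      (x : Set.Icc (a j) (b j)) => 1 / (nodal (p.2 j)).eval (x : ℝ)) := fun j => by
    refine continuous_const.div (continuous_eval_nodal ?_ (by fun_prop)) fun q => hW q.1.2 j q.2
    exact (continuous_apply j).comp (by fun_prop)
  have hg' : ∀ j, Continuous (Function.uncurry fun
      (p : (∀ j, Fin (n j) → Set.Icc (a j) (b j)) × (∀ j, Fin (N j) → Set.Icc a₀ b₀))
      (z : Set.Icc a₀ b₀) => cauchyIntegral μ p.1 p.2 j z /
        ((denom p.1).eval (z : ℝ) * (nodal (p.1 j)).eval (z : ℝ))) := fun j => by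
    refine (continuous_cauchyIntegral hμ hd₀ j).div
      ((continuous_eval_denom (by fun_prop) (by fun_prop)).mul
        (continuous_eval_nodal ?_ (by fun_prop))) fun q => hTQ q.1.1 j q.2
    exact (continuous_apply j).comp (by fun_prop)
  obtain ⟨τ, hτc, hτ⟩ := exists_continuous_zeros (μ := μ)
    (X := (∀ j, Fin (n j) → Set.Icc (a j) (b j)) × (∀ j, Fin (N j) → Set.Icc a₀ b₀)) n
    (g := fun p j x => 1 / (nodal (p.2 j)).eval (x : ℝ))
    (fun p => ⟨hd, hμ, hμ0, fun j => (hg j).comp (by fun_prop : Continuous fun x => (p, x)),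
      fun j x => one_div_ne_zero (hW p.2 j x)⟩) hg
  have hω : ∀ j, ∃ ω : (∀ j, Fin (n j) → Set.Icc (a j) (b j)) × (∀ j, Fin (N j) → Set.Icc a₀ b₀) →
      Fin (N j) → Set.Icc a₀ b₀, Continuous ω ∧ ∀ p, ∀ k < N j, ∫ z : Set.Icc a₀ b₀, (z : ℝ) ^ k *
        ((nodal (ω p)).eval (z : ℝ) * (cauchyIntegral μ p.1 p.2 j z /
          ((denom p.1).eval (z : ℝ) * (nodal (p.1 j)).eval (z : ℝ)))) ∂μ₀ = 0 := by
    intro j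
    have h0 := fun (p : (∀ j, Fin (n j) → Set.Icc (a j) (b j)) × (∀ j, Fin (N j) → Set.Icc a₀ b₀))
      (z : Set.Icc a₀ b₀) =>
      div_ne_zero (cauchyIntegral_ne_zero hμ hμ0 hd hd₀ p.1 p.2 j z) (hTQ p.1 j z)
    have h1 := exists_continuous_zeros_single hμ₀ (N j) (hg' j)
    have h2 := h1 h0
    exact h2
  choose ω hωc hω using hω
  obtain ⟨p, hp⟩ := exists_fixedPoint_zeros hab hab₀ (f := fun p => (τ p, fun j => ω j p))
    (hτc.prodMk (continuous_pi hωc))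
  have h1 : τ p = p.1 := congrArg Prod.fst hp
  have h2 : ∀ j, ω j p = p.2 j := fun j => congrFun (congrArg Prod.snd hp) j
  refine ⟨p.1, p.2, fun j k hk => ?_, fun j k hk => ?_⟩
  · have := hτ p j k hk
    rwa [h1] at this
  · have := hω j p k hk
    rwa [h2 j] at this

end FixedPoint
end FourierPade

theorem mainTheorem5 (m : ℕ) (Δ₀ : Set ℝ) (Δ : Fin m → Set ℝ)
    (hΔ₀ : Δ₀.OrdConnected) (hΔ : ∀ j, (Δ j).OrdConnected)
    (hdisj₀ : ∀ j, Disjoint Δ₀ (Δ j)) (hdisj : ∀ j k, j ≠ k → Disjoint (Δ j) (Δ k))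
    (σ₀ : MeasureTheory.Measure ℝ) (σ : Fin m → MeasureTheory.Measure ℝ)
    (hσ₀ : FourierPade.InClass Δ₀ σ₀) (hσ : ∀ j, FourierPade.InClass (Δ j) (σ j))
    (n : Fin m → ℕ) :
    ∃ R : Fin m → RatFunc ℝ, FourierPade.IsNonlinearFourierPade σ₀ σ n R := by
  open FourierPade in
  obtain ⟨a₀, b₀, hab₀, hsub₀, μ₀, hfin₀, hμ₀, rfl⟩ := hσ₀.exists_measure_Icc hΔ₀
  choose a b hab hsub μ hfin hμ hσμ using fun j => (hσ j).exists_measure_Icc (hΔ j)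
  have hd₀ : ∀ j, Disjoint (Set.Icc a₀ b₀) (Set.Icc (a j) (b j)) := fun j =>
    (hdisj₀ j).mono hsub₀ (hsub j)
  have hd : ∀ j k, j ≠ k → Disjoint (Set.Icc (a j) (b j)) (Set.Icc (a k) (b k)) := fun j k h =>
    (hdisj j k h).mono (hsub j) (hsub k)
  have hemb : ∀ c d : ℝ, MeasurableEmbedding ((↑) : Set.Icc c d → ℝ) := fun c d =>
    MeasurableEmbedding.subtype_coe measurableSet_Icc
  set M := ∑ i, n i
  -- `w j` are the points where `S j / T` interpolates the Markov function of `σ j`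
  obtain ⟨t, w, ht, hw⟩ := exists_coupled_orthogonal hab hab₀ hfin hμ hμ₀ hd hd₀ n
    (fun j => M + n j)
  have hTdeg : (denom t).natDegree = M := natDegree_eq_of_degree_eq_some (denom_degree t)
  have hT0 : ∀ z : Set.Icc a₀ b₀, (denom t).eval (z : ℝ) ≠ 0 := fun z =>
    eval_denom_ne_zero t fun j => notMem_Icc_right hd₀ j z
  have hWne : ∀ j (x : Set.Icc (a j) (b j)), (nodal (w j)).eval (x : ℝ) ≠ 0 := fun j x =>
    eval_nodal_ne_zero _ (notMem_Icc_left hd₀ j x)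
  choose S hSdeg hS using fun j =>
    have := hfin j
    exists_numerator (μ := μ j) (hWne j) (ht j) hTdeg.le (nodal_natDegree (w j)).le
  have herr : ∀ j (z : Set.Icc a₀ b₀), approxError (σ j) (S j) (denom t) z =
      (nodal (w j)).eval (z : ℝ) * (cauchyIntegral μ t w j z /
        ((denom t).eval (z : ℝ) * (nodal (t j)).eval (z : ℝ))) := by
    intro j z
    have := hfin j
    have hz := notMem_Icc_right hd₀ j z
    have h1 := hS j z hz
    have h2 := eval_mul_integral_cauchy (hWne j) (ht j) (nodal_natDegree (t j)).le hz
    have h3 : markov (σ j) z = ∫ x : Set.Icc (a j) (b j), 1 / ((z : ℝ) - x) ∂(μ j) := by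
      rw [markov, hσμ j, (hemb _ _).integral_map]
    have hQ := eval_nodal_ne_zero (t j) hz
    have hT := hT0 z
    rw [approxError, h3, cauchyIntegral, ← h2]
    field_simp
    linear_combination h1
  have hcont : ∀ j, Continuous fun z : Set.Icc a₀ b₀ => approxError (σ j) (S j) (denom t) z := by
    intro j
    simp only [herr]
    have hc := continuous_cauchyIntegral_right hfin hd₀ t w j
    have hTQ : ∀ z : Set.Icc a₀ b₀, (denom t).eval (z : ℝ) * (nodal (t j)).eval (z : ℝ) ≠ 0 :=
      fun z => mul_ne_zero (hT0 z) (eval_nodal_ne_zero (t j) (notMem_Icc_right hd₀ j z))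
    exact Continuous.mul (by fun_prop) (hc.div (by fun_prop) hTQ)
  refine ⟨_, denom t, S, ⟨(denom_monic t).ne_zero, (denom_degree t).le, hSdeg, ?_, ?_, ?_⟩,
    fun j => rfl⟩
  · rw [(hemb _ _).ae_map_iff]
    exact Filter.Eventually.of_forall hT0
  · intro j k _
    rw [(hemb _ _).integrable_map_iff]
    have := hcont j
    exact integrable_of_continuous μ₀ (by
      simp only [Function.comp_def]
      fun_prop)
  · intro j k hk
    have hdeg : (orthonormalPoly (μ₀.map ((↑) : Set.Icc a₀ b₀ → ℝ)) k).degree <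
        ((M + n j : ℕ) : WithBot ℕ) := by
      rw [((orthonormalPoly_spec hσ₀).1 k).1]
      exact_mod_cast hk
    rw [fourierCoefficient, (hemb _ _).integral_map]
    simp only [mul_comm (approxError _ _ _ _)]
    refine integral_eval_mul_eq_zero (hcont j) (fun i hi => ?_) hdeg
    simp only [herr]
    exact hw j i hi
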